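/- All groups are finite. For subsets $X, Y$ of a group, $XY=\{xy : x\in X,\ y\in Y\}$. Subgroups $A$ and $B$ of a group $G$ are called mutually permutable if $UB=BU$ for every subgroup $U\le A$ and $AV=VA$ for every subgroup $V\le B$. They are called msp-permutable if $AB$ is a subgroup of $G$ and, for all primes $p\neq q$, every Sylow $p$-subgroup of $A$ and every Sylow $q$-subgroup of $B$ are mutually permutable. A subgroup $H$ of $G$ is called $\mathbb{P}$-subnormal in $G$ if $H=G$ or there is a chain of subgroups $H=H_0\le H_1\le\dots\le H_n=G$ such that every index $|H_i:H_{i-1}|$, $1\le i\le n$, is a prime. A group is supersoluble if all its chief factors have prime order; it is w-supersoluble if each of its Sylow subgroups is $\mathbb{P}$-subnormal in it; it is v-supersoluble if each of its cyclic subgroups of prime power order is $\mathbb{P}$-subnormal in it. **Corollary.** Let $G$ be a finite group and let $G_1, G_2$ be msp-permutable subgroups of $G$ with $G=G_1G_2$. 1. If $G_1$ and $G_2$ are supersoluble, then $G$ is supersoluble. 2. If $G_1$ and $G_2$ are w-supersoluble, then $G$ is w-supersoluble. 3. If $G_1$ and $G_2$ are v-supersoluble, then $G$ is v-supersoluble.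 -/

import Mathlib

open scoped Pointwise

namespace MspPermutable

/-- `A` and `B` are mutually permutable: `UB = BU` for all `U ≤ A` and `AV = VA` for all `V ≤ B`
(products of subsets of `G`). -/
def MutuallyPermutable {G : Type*} [Group G] (A B : Subgroup G) : Prop :=
  (∀ U : Subgroup G, U ≤ A → (U : Set G) * (B : Set G) = (B : Set G) * (U : Set G)) ∧
  (∀ V : Subgroup G, V ≤ B → (A : Set G) * (V : Set G) = (V : Set G) * (A : Set G))

/-- `A` and `B` are msp-permutable: `AB` is a subgroup of `G`, and for distinct primes `p ≠ q` every
Sylow `p`-subgroup of `A` and every Sylow `q`-subgroup of `B`, viewed as subgroups of `G`, are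
mutually permutable. -/
def IsMspPermutable {G : Type*} [Group G] (A B : Subgroup G) : Prop :=
  (∃ H : Subgroup G, (H : Set G) = (A : Set G) * (B : Set G)) ∧
  ∀ p q : ℕ, p.Prime → q.Prime → p ≠ q → ∀ (P : Sylow p A) (Q : Sylow q B),
    MutuallyPermutable ((P : Subgroup A).map A.subtype) ((Q : Subgroup B).map B.subtype)

/-- `H / K` is a chief factor of `G`: `K < H` are normal subgroups of `G` and no normal subgroup of
`G` lies strictly between them. -/
def IsChiefFactor {G : Type*} [Group G] (K H : Subgroup G) : Prop :=
  K.Normal ∧ H.Normal ∧ K < H ∧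
  ∀ L : Subgroup G, L.Normal → K ≤ L → L ≤ H → L = K ∨ L = H

/-- Every chief factor of the (finite) group `G` has prime order. -/
def IsSupersoluble (G : Type*) [Group G] : Prop :=
  ∀ K H : Subgroup G, IsChiefFactor K H → (K.relIndex H).Prime

/-- `H` is `ℙ`-subnormal in `G`: there is a chain `H = H₀ ≤ H₁ ≤ … ≤ Hₙ = G` in which every index
`|Hᵢ₊₁ : Hᵢ|` is prime; `n = 0` is the case `H = G`. -/
def IsPrimeSubnormal {G : Type*} [Group G] (H : Subgroup G) : Prop :=
  ∃ (n : ℕ) (c : ℕ → Subgroup G), c 0 = H ∧ c n = ⊤ ∧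
    ∀ i < n, c i ≤ c (i + 1) ∧ ((c i).relIndex (c (i + 1))).Prime

/-- Every Sylow subgroup of `G` is `ℙ`-subnormal in `G`. -/
def IsWSupersoluble (G : Type*) [Group G] : Prop :=
  ∀ p : ℕ, p.Prime → ∀ P : Sylow p G, IsPrimeSubnormal (P : Subgroup G)

/-- Every primary cyclic subgroup of `G` (cyclic of prime power order) is `ℙ`-subnormal in `G`. -/
def IsVSupersoluble (G : Type*) [Group G] : Prop :=
  ∀ C : Subgroup G, IsCyclic C → (∃ p k : ℕ, p.Prime ∧ Nat.card C = p ^ k) → IsPrimeSubnormal C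

end MspPermutable

/-!
The theorem is proved by induction on the order of `G = AB`, in the same way for the three classes.
Subgroups are compared through `PrimeChain T H K`: a chain from `H` to `K` of `T`-invariant
subgroups with prime indices. A subgroup `H` is `ℙ`-subnormal if and only if there is such a chain
from `H` to `G` for `T = 1`, and `G` is supersoluble if and only if there is one from `1` to `G` for
`T = G` (`isSupersoluble_iff`). Hence supersoluble groups are w-supersoluble, and these are
v-supersoluble.

Let `p` be the largest prime divisor of the order of `G`. If `H` has prime index `r ≤ p` in `K`,
then `H` modulo its core in `K` is a `p'`-group, so a normal `p`-subgroup of `H` lies in a normal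
`p`-subgroup of `K`. Therefore v-supersoluble groups have a normal Sylow `p`-subgroup
(`IsVSupersoluble.normal_sylow`); let `P` and `R` be those of `A` and `B`. By the same argument a
Sylow `q`-subgroup of `A`, `q ≠ p`, normalizes `R`, and then mutual permutability makes it normalize
every subgroup of `R` (`MutuallyPermutable.le_normalizer`). By symmetry and `exists_sylow_mul`,
`S = PR` is a normal Sylow `p`-subgroup of `G`; this is the structure `PowerFactorization`.

By induction `G / S` is in the class, and it remains to study the action of `G` on `S`, or rather
`G / S C_G(S)`, which is a `p'`-group: an element acting on `S` with `p`-power order lies in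
`S C_G(S)`. A subgroup `T` has a `T`-invariant chain with prime indices in `S` if and only if its
image in `G / S C_G(S)` is abelian of exponent dividing `p - 1` (`PrimeChain.actsAsPElement` and
`ActsAbelian.primeChain`; for the second, commuting operators whose orders divide `p - 1` have a
common eigenvector). So membership of `G` in one of the classes means that `G / S` is in the class
and that the images of certain subgroups are abelian of exponent dividing `p - 1`: of `G` itself, of
its Sylow `q`-subgroups, or of its cyclic `q`-subgroups, for `q ≠ p`.

An element normalizing all subgroups of the `p`-group `R` raises all its elements to powers whose
exponents agree modulo `p` (`exists_uniform_exponent`). Up to `p`-power order it therefore commutes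
with everything that normalizes `R`, and its order divides `p - 1`. Such elements generate `A`
modulo `P`, and the elements of `B` act likewise on `P`. Hence the images of `A` and `B` in
`G / S C_G(S)` commute elementwise, and on each of them the required conditions follow from
those on the action of `A` on `P` and of `B` on `R`. As `G = AB`, and some Sylow `q`-subgroup of `G`
is a product of Sylow `q`-subgroups of `A` and `B`, the conditions hold for `G`.
-/

namespace MspPermutable

open Subgroup
open scoped commutatorElement

universe u

variable {G G' : Type*} [Group G] [Group G']

/-! ### Chains of subgroups with prime indices -/

/-- If `Z = MX` for subgroups `X`, `M` of `Z`, then `|Z : X| = |M : M ∩ X|`. -/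
theorem relIndex_eq_of_subset_mul {X M Z : Subgroup G} (hM : M ≤ Z)
    (h : (Z : Set G) ⊆ (M : Set G) * (X : Set G)) : X.relIndex Z = X.relIndex M := by
  rw [relIndex, relIndex, index, index]
  symm
  refine Nat.card_congr (Equiv.ofBijective
    (Quotient.map' (Subgroup.inclusion hM) ?_) ⟨?_, ?_⟩)
  · intro a b hab
    rw [QuotientGroup.leftRel_apply, mem_subgroupOf] at hab ⊢
    exact hab
  · intro a b
    induction a using QuotientGroup.induction_on with | H a => ?_
    induction b using QuotientGroup.induction_on with | H b => ?_
    intro hab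
    exact QuotientGroup.eq.2 (QuotientGroup.eq.1 hab :)
  · intro z
    induction z using QuotientGroup.induction_on with | H z => ?_
    obtain ⟨m, hm, x, hx, hz⟩ := h z.2
    refine ⟨QuotientGroup.mk ⟨m, hm⟩, Quotient.sound ?_⟩
    refine QuotientGroup.leftRel_apply.2 ?_
    have hz' : m * x = (z : G) := hz
    rw [mem_subgroupOf]
    simpa [← hz'] using hx

/-- `H` has prime index in `K`, and `T` normalizes both. -/
def PrimeStep (T H K : Subgroup G) : Prop :=
  H ≤ K ∧ (H.relIndex K).Prime ∧ T ≤ normalizer (H : Set G) ∧ T ≤ normalizer (K : Set G)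

/-- There is a finite chain of `T`-invariant subgroups from `H` up to `K`, each of prime index in
the next. For `T = ⊥` the invariance is no condition, for `T = ⊤` the members are normal. -/
def PrimeChain (T : Subgroup G) : Subgroup G → Subgroup G → Prop :=
  Relation.ReflTransGen (PrimeStep T)

theorem PrimeChain.le {T H K : Subgroup G} (h : PrimeChain T H K) : H ≤ K := by
  induction h with
  | refl => exact le_rfl
  | tail _ h2 ih => exact ih.trans h2.1

theorem PrimeChain.mono {T T' H K : Subgroup G} (h : PrimeChain T H K) (hT : T' ≤ T) :
    PrimeChain T' H K :=
  Relation.ReflTransGen.mono (r := PrimeStep T) (p := PrimeStep T')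
    (fun _ _ h => ⟨h.1, h.2.1, hT.trans h.2.2.1, hT.trans h.2.2.2⟩) _ _ h

theorem PrimeChain.trans {T H K L : Subgroup G} (h : PrimeChain T H K) (h' : PrimeChain T K L) :
    PrimeChain T H L :=
  Relation.ReflTransGen.trans h h'

/-- Chains are preserved by any operation on subgroups under which each index of the chain is
replaced by one of its divisors. -/
theorem PrimeChain.lift {T H K : Subgroup G} {T' : Subgroup G'} (F : Subgroup G → Subgroup G')
    (hF : ∀ X Y, H ≤ X → Y ≤ K → PrimeStep T X Y → F X ≤ F Y ∧ (F X).relIndex (F Y) ∣ X.relIndex Y ∧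
      T' ≤ normalizer (F X : Set G') ∧ T' ≤ normalizer (F Y : Set G'))
    (h : PrimeChain T H K) : PrimeChain T' (F H) (F K) := by
  suffices ∀ L, L ≤ K → PrimeChain T H L → PrimeChain T' (F H) (F L) from this K le_rfl h
  intro L hL h
  induction h with
  | refl => exact .refl
  | @tail X Y h1 h2 ih =>
    have h3 := hF X Y (PrimeChain.le h1) hL h2
    have ih := ih (h2.1.trans hL)
    rcases (Nat.dvd_prime h2.2.1).1 h3.2.1 with h4 | h4
    · rwa [le_antisymm (relIndex_eq_one.1 h4) h3.1]
    · exact ih.tail ⟨h3.1, h4 ▸ h2.2.1, h3.2.2⟩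

theorem isPrimeSubnormal_iff {H : Subgroup G} : IsPrimeSubnormal H ↔ PrimeChain ⊥ H ⊤ := by
  constructor
  · rintro ⟨n, c, h0, hn, h⟩
    have : ∀ i ≤ n, PrimeChain ⊥ H (c i) := by
      intro i
      induction i with
      | zero => exact fun _ => h0 ▸ .refl
      | succ i ih =>
        intro hi
        exact (ih (by omega)).tail ⟨(h i (by omega)).1, (h i (by omega)).2, bot_le, bot_le⟩
    exact hn ▸ this n le_rfl
  · intro h
    suffices ∀ K, PrimeChain ⊥ H K → ∃ (n : ℕ) (c : ℕ → Subgroup G), c 0 = H ∧ c n = K ∧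
      ∀ i < n, c i ≤ c (i + 1) ∧ ((c i).relIndex (c (i + 1))).Prime from this ⊤ h
    intro K h
    induction h with
    | refl => exact ⟨0, fun _ => H, rfl, rfl, by simp⟩
    | @tail X Y _ h2 ih =>
      obtain ⟨n, c, h0, hn, hc⟩ := ih
      refine ⟨n + 1, fun i => if i ≤ n then c i else Y, by simpa using h0, by simp, ?_⟩
      intro i hi
      rcases Nat.lt_or_ge i n with h | h
      · simpa [h.le, Nat.succ_le_of_lt h] using hc i h
      · obtain rfl : i = n := by omega
        simpa [hn] using ⟨h2.1, h2.2.1⟩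

/-- The members of a chain starting at `T` are normalized by `T`. -/
theorem PrimeChain.of_bot {T K : Subgroup G} (h : PrimeChain ⊥ T K) : PrimeChain T T K :=
  h.lift id fun _ _ hX _ h => ⟨h.1, dvd_rfl, hX.trans le_normalizer,
    (hX.trans h.1).trans le_normalizer⟩

theorem PrimeChain.map {T H K : Subgroup G} (h : PrimeChain T H K) (f : G →* G') :
    PrimeChain (T.map f) (H.map f) (K.map f) := by
  refine h.lift _ fun X Y _ _ h => ⟨map_mono h.1, ?_, ?_, ?_⟩
  · rw [relIndex_map_map]
    have h2 : (X ⊔ f.ker).relIndex (Y ⊔ f.ker) = (X ⊔ f.ker).relIndex Y := by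
      refine relIndex_eq_of_subset_mul le_sup_left ?_
      rw [mul_normal]
      exact Set.mul_subset_mul_left (SetLike.coe_subset_coe.2 le_sup_right)
    rw [h2]
    exact relIndex_dvd_of_le_left _ le_sup_left
  · exact (map_mono h.2.2.1).trans (le_normalizer_map f)
  · exact (map_mono h.2.2.2).trans (le_normalizer_map f)

theorem PrimeChain.comap {f : G →* G'} (hf : Function.Surjective f) {T H K : Subgroup G'}
    (h : PrimeChain T H K) : PrimeChain (T.comap f) (H.comap f) (K.comap f) := by
  refine h.lift _ fun X Y _ _ h => ⟨comap_mono h.1, ?_, ?_, ?_⟩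
  · rw [relIndex_comap, map_comap_eq_self_of_surjective hf]
  · exact (comap_mono h.2.2.1).trans (le_normalizer_comap f)
  · exact (comap_mono h.2.2.2).trans (le_normalizer_comap f)

theorem le_normalizer_inf {T X Y : Subgroup G} (hX : T ≤ normalizer (X : Set G))
    (hY : T ≤ normalizer (Y : Set G)) : T ≤ normalizer ((X ⊓ Y : Subgroup G) : Set G) := by
  rw [le_normalizer_iff] at *
  exact fun t ht x hx => ⟨hX t ht x hx.1, hY t ht x hx.2⟩

theorem le_normalizer_of_normal (T X : Subgroup G) [hX : X.Normal] :
    T ≤ normalizer (X : Set G) := by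
  rw [normalizer_eq_top]
  exact le_top

theorem relIndex_inf_dvd {X Y : Subgroup G} (h : X ≤ Y) (S : Subgroup G) [S.Normal] :
    (X ⊓ S).relIndex (Y ⊓ S) ∣ X.relIndex Y := by
  have h1 : (X ⊓ S).relIndex (Y ⊓ S) = X.relIndex (Y ⊓ S) := by
    rw [← inf_relIndex_right, ← inf_relIndex_right X]
    congr 1
    rw [inf_assoc, inf_eq_right.2 (inf_le_right : Y ⊓ S ≤ S)]
  have h2 : X.relIndex (X ⊔ Y ⊓ S) = X.relIndex (Y ⊓ S) := by
    refine relIndex_eq_of_subset_mul le_sup_right ?_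
    intro z hz
    have hz' : z ∈ Y ⊓ (S ⊔ X) :=
      (sup_le (le_inf h le_sup_right) (inf_le_inf_left _ le_sup_left) : X ⊔ Y ⊓ S ≤ _) hz
    have hzY : z ∈ Y := hz'.1
    have hzS : z ∈ ((S ⊔ X : Subgroup G) : Set G) := hz'.2
    rw [normal_mul] at hzS
    obtain ⟨s, hs, x, hx, rfl⟩ := hzS
    refine ⟨s, ⟨?_, hs⟩, x, hx, rfl⟩
    have := Y.mul_mem hzY (Y.inv_mem (h hx))
    simpa using this
  rw [h1, ← h2, ← relIndex_mul_relIndex _ _ _ le_sup_left (sup_le h inf_le_left)]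
  exact dvd_mul_right _ _

theorem PrimeChain.inf_normal {T H K : Subgroup G} (h : PrimeChain T H K) (S : Subgroup G)
    [S.Normal] : PrimeChain T (H ⊓ S) (K ⊓ S) :=
  h.lift (fun X => X ⊓ S) fun _ _ _ _ h => ⟨inf_le_inf_right _ h.1, relIndex_inf_dvd h.1 S,
    le_normalizer_inf h.2.2.1 (le_normalizer_of_normal _ _),
    le_normalizer_inf h.2.2.2 (le_normalizer_of_normal _ _)⟩

/-- Multiplying an `X`-invariant chain by `X`. -/
theorem PrimeChain.sup {X H K : Subgroup G} (h : PrimeChain X H K) :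
    PrimeChain ⊥ (X ⊔ H) (X ⊔ K) := by
  refine h.lift (fun Y => X ⊔ Y) fun Y Z _ _ h => ⟨sup_le_sup_left h.1 _, ?_, bot_le, bot_le⟩
  have h2 : (X ⊔ Y).relIndex (X ⊔ Z) = (X ⊔ Y).relIndex Z := by
    refine relIndex_eq_of_subset_mul le_sup_right ?_
    rw [sup_comm X Z, coe_mul_of_right_le_normalizer_left Z X h.2.2.2]
    exact Set.mul_subset_mul_left (SetLike.coe_subset_coe.2 le_sup_left)
  rw [h2]
  exact relIndex_dvd_of_le_left _ le_sup_right

/-! ### The three classes: comparison and quotients -/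

theorem mem_of_pow_mem_of_coprime {H : Subgroup G} {x : G} {m : ℕ} (h : (orderOf x).Coprime m)
    (hx : x ^ m ∈ H) : x ∈ H := by
  obtain ⟨j, hj⟩ := exists_pow_eq_self_of_coprime h.symm
  exact hj ▸ pow_mem hx j

theorem normal_of_top_le_normalizer {H : Subgroup G} (h : ⊤ ≤ normalizer (H : Set G)) :
    H.Normal :=
  normalizer_eq_top_iff.1 (top_le_iff.1 h)

/-- A finite group is supersoluble if and only if it has a normal series with prime indices. -/
theorem isSupersoluble_iff [Finite G] : IsSupersoluble G ↔ PrimeChain ⊤ (⊥ : Subgroup G) ⊤ := by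
  constructor
  · intro hG
    suffices ∀ K : Subgroup G, K.Normal → PrimeChain ⊤ K ⊤ from this ⊥ inferInstance
    intro K
    induction K using WellFoundedGT.induction with
    | ind K ih =>
      intro hK
      rcases eq_or_ne K ⊤ with rfl | hne
      · exact .refl
      obtain ⟨H, hH⟩ := (Set.toFinite {H : Subgroup G | H.Normal ∧ K < H}).exists_minimal
        ⟨⊤, inferInstance, lt_top_iff_ne_top.2 hne⟩
      have hHn : H.Normal := hH.prop.1
      have hKH : K < H := hH.prop.2
      have hc : IsChiefFactor K H := by
        refine ⟨hK, hHn, hKH, fun L hL hKL hLH => ?_⟩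
        rcases hKL.eq_or_lt with h | h
        · exact Or.inl h.symm
        · exact Or.inr (hLH.antisymm (hH.le_of_le ⟨hL, h⟩ hLH))
      exact .head ⟨hKH.le, hG K H hc, le_normalizer_of_normal _ _, le_normalizer_of_normal _ _⟩
        (ih H hKH hHn)
  · rintro hG K H ⟨hK, hH, hlt, hmin⟩
    suffices ∀ L, PrimeChain ⊤ (⊥ : Subgroup G) L → H ⊓ L ≤ K ∨ (K.relIndex H).Prime by
      rcases this ⊤ hG with h | h
      · exact absurd (by simpa using h) hlt.not_ge
      · exact h
    intro L hL
    induction hL with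
    | refl => exact Or.inl (by simp)
    | @tail X Y _ h2 ih =>
      rcases ih with ih | ih
      swap
      · exact Or.inr ih
      by_cases hY : H ⊓ Y ≤ K
      · exact Or.inl hY
      have hYn : Y.Normal := normal_of_top_le_normalizer h2.2.2.2
      have hsup : K ⊔ H ⊓ Y = H := by
        refine (hmin _ inferInstance le_sup_left (sup_le hlt.le inf_le_left)).resolve_left ?_
        exact fun h => hY (h ▸ le_sup_right)
      have h3 : K.relIndex H ∣ X.relIndex Y := by
        conv_lhs => rw [← hsup, relIndex_sup_left]
        refine (relIndex_dvd_of_le_left _ ih).trans ?_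
        rw [inf_comm H, inf_comm H]
        exact relIndex_inf_dvd h2.1 H
      rcases (Nat.dvd_prime h2.2.1).1 h3 with h4 | h4
      · exact absurd (relIndex_eq_one.1 h4) hlt.not_ge
      · exact Or.inr (h4 ▸ h2.2.1)

theorem IsSupersoluble.isPrimeSubnormal [Finite G] (hG : IsSupersoluble G) (H : Subgroup G) :
    IsPrimeSubnormal H := by
  rw [isSupersoluble_iff] at hG
  have := (hG.mono (le_top : H ≤ ⊤)).sup
  rw [isPrimeSubnormal_iff]
  simpa using this

theorem IsSupersoluble.isWSupersoluble [Finite G] (hG : IsSupersoluble G) : IsWSupersoluble G :=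
  fun _ _ _ => hG.isPrimeSubnormal _

theorem primeChain_top_of_isPGroup [Finite G] {p : ℕ} [hp : Fact p.Prime] (hG : IsPGroup p G)
    (C : Subgroup G) : PrimeChain ⊥ C ⊤ := by
  induction C using WellFoundedGT.induction with
  | ind C ih =>
    rcases eq_or_ne C ⊤ with rfl | hne
    · exact .refl
    obtain ⟨n, hn⟩ := IsPGroup.iff_card.1 (hG.to_subgroup C)
    obtain ⟨m, hm⟩ := IsPGroup.iff_card.1 hG
    have hlt : Nat.card C < Nat.card G := by
      refine lt_of_le_of_ne (Nat.le_of_dvd Nat.card_pos C.card_subgroup_dvd_card) fun h => hne ?_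
      exact Subgroup.eq_top_of_card_eq C h
    have hnm : n < m := by
      rw [hn, hm] at hlt
      exact (Nat.pow_lt_pow_iff_right hp.out.one_lt).1 hlt
    obtain ⟨K, hK, hCK⟩ := Sylow.exists_subgroup_card_pow_succ (hm ▸ pow_dvd_pow p hnm) hn
    have hidx : C.relIndex K = p := by
      have h1 := relIndex_mul_relIndex ⊥ C K bot_le hCK
      rw [relIndex_bot_left, relIndex_bot_left, hK, hn, pow_succ] at h1
      exact Nat.eq_of_mul_eq_mul_left (pow_pos hp.out.pos n) h1
    have hCK' : C < K := by
      refine lt_of_le_of_ne hCK fun h => ?_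
      rw [h, relIndex_self] at hidx
      exact hp.out.one_lt.ne hidx
    exact .head ⟨hCK, hidx ▸ hp.out, bot_le, bot_le⟩ (ih K hCK')

theorem primeChain_of_isPGroup [Finite G] {p : ℕ} [Fact p.Prime] {C P : Subgroup G}
    (hP : IsPGroup p P) (hCP : C ≤ P) : PrimeChain ⊥ C P := by
  have h := (primeChain_top_of_isPGroup hP (C.subgroupOf P)).map P.subtype
  simpa [← MonoidHom.range_eq_map, hCP] using h

theorem IsWSupersoluble.isVSupersoluble [Finite G] (hG : IsWSupersoluble G) :
    IsVSupersoluble G := by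
  rintro C _ ⟨p, k, hp, hC⟩
  have := Fact.mk hp
  obtain ⟨P, hP⟩ := (IsPGroup.of_card hC).exists_le_sylow
  rw [isPrimeSubnormal_iff]
  exact (primeChain_of_isPGroup P.isPGroup' hP).trans (isPrimeSubnormal_iff.1 (hG p hp P))

theorem IsPrimeSubnormal.map {H : Subgroup G} (h : IsPrimeSubnormal H) {f : G →* G'}
    (hf : Function.Surjective f) : IsPrimeSubnormal (H.map f) := by
  rw [isPrimeSubnormal_iff] at *
  simpa [map_top_of_surjective f hf] using h.map f

theorem IsPrimeSubnormal.comap {H : Subgroup G'} (h : IsPrimeSubnormal H) {f : G →* G'}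
    (hf : Function.Surjective f) : IsPrimeSubnormal (H.comap f) := by
  rw [isPrimeSubnormal_iff] at *
  simpa using (h.comap hf).mono bot_le

theorem IsSupersoluble.of_surjective [Finite G] (hG : IsSupersoluble G) {f : G →* G'}
    (hf : Function.Surjective f) : IsSupersoluble G' := by
  have := Finite.of_surjective f hf
  rw [isSupersoluble_iff] at *
  simpa [map_top_of_surjective f hf] using hG.map f

theorem IsWSupersoluble.of_surjective [Finite G] (hG : IsWSupersoluble G) {f : G →* G'}
    (hf : Function.Surjective f) : IsWSupersoluble G' := by
  intro p hp P
  have := Fact.mk hp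
  obtain ⟨Q, rfl⟩ := Sylow.mapSurjective_surjective hf p P
  rw [Sylow.coe_mapSurjective]
  exact (hG p hp Q).map hf

theorem IsVSupersoluble.isPrimeSubnormal_zpowers [Finite G] (hG : IsVSupersoluble G)
    {p k : ℕ} (hp : p.Prime) {x : G} (hx : orderOf x = p ^ k) : IsPrimeSubnormal (zpowers x) :=
  hG _ inferInstance ⟨p, k, hp, by rw [Nat.card_zpowers, hx]⟩

theorem IsVSupersoluble.of_surjective [Finite G] (hG : IsVSupersoluble G) {f : G →* G'}
    (hf : Function.Surjective f) : IsVSupersoluble G' := by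
  have := Finite.of_surjective f hf
  rintro C hC ⟨p, k, hp, hCk⟩
  have := Fact.mk hp
  obtain ⟨g, rfl⟩ := (Subgroup.isCyclic_iff_exists_zpowers_eq_top C).1 hC
  rw [Nat.card_zpowers] at hCk
  obtain ⟨x, rfl⟩ := hf g
  obtain ⟨a, m, hm, ha⟩ := Nat.exists_eq_pow_mul_and_not_dvd (orderOf_pos x).ne' p hp.ne_one
  -- the `p`-part `x ^ m` of `x` still maps to a generator, as `m` is prime to `p`
  have h1 : orderOf (x ^ m) = p ^ a := by
    rw [orderOf_pow_of_dvd (fun h => hm (by simp [h])) (ha ▸ dvd_mul_left m _), ha]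
    exact Nat.mul_div_cancel _ (Nat.pos_of_ne_zero fun h => hm (by simp [h]))
  have h2 : zpowers (f x) = (zpowers (x ^ m)).map f := by
    rw [MonoidHom.map_zpowers, map_pow]
    refine le_antisymm (zpowers_le.2 ?_) (zpowers_le.2 (pow_mem (mem_zpowers _) m))
    have hco : (orderOf (f x)).Coprime m := by
      rw [hCk]
      exact Nat.Coprime.pow_left _ ((hp.coprime_iff_not_dvd).2 hm)
    exact mem_of_pow_mem_of_coprime hco (mem_zpowers _)
  rw [h2]
  exact (hG.isPrimeSubnormal_zpowers hp h1).map hf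

/-! ### The Sylow subgroup for the largest prime -/

/-- A normal `p`-subgroup of a normal subgroup `C` lies in the largest normal `p`-subgroup of `C`,
which is characteristic in `C` and so normal in `G`. -/
theorem exists_normal_isPGroup_of_normal [Finite G] {p : ℕ} (C : Subgroup G) [C.Normal]
    {N : Subgroup G} (hN : IsPGroup p N) (hNC : N ≤ C) (hCN : C ≤ normalizer (N : Set G)) :
    ∃ M : Subgroup G, M.Normal ∧ N ≤ M ∧ IsPGroup p M := by
  -- the largest normal `p`-subgroup of `C`
  let O : Subgroup C := sSup {L | L.Normal ∧ IsPGroup p L}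
  have hO : IsPGroup p O := Sylow.sSup_of_normal _ (fun L hL => hL.2) fun L hL => hL.1
  have hchar : O.Characteristic := by
    rw [characteristic_iff_map_le]
    intro φ
    rw [map_le_iff_le_comap]
    refine sSup_le fun L hL => ?_
    rw [← map_le_iff_le_comap]
    exact le_sSup ⟨hL.1.map _ φ.surjective, hL.2.map _⟩
  refine ⟨O.map C.subtype, inferInstance, ?_, hO.map _⟩
  have h1 : N.subgroupOf C ≤ O :=
    le_sSup ⟨(normal_subgroupOf_iff_le_normalizer hNC).2 hCN, hN.comap_subtype⟩
  simpa [hNC] using map_mono (f := C.subtype) h1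

/-- A normal `p`-subgroup of a subgroup of prime index `r ≤ p` lies in a normal `p`-subgroup of the
whole group, because it lies in the core of the subgroup. -/
theorem exists_normal_isPGroup_of_index_prime [Finite G] {p r : ℕ} [hp : Fact p.Prime]
    {H N : Subgroup G} (hr : r.Prime) (hH : H.index = r) (hrp : r ≤ p) (hN : IsPGroup p N)
    (hNH : N ≤ H) (hHN : H ≤ normalizer (N : Set G)) :
    ∃ M : Subgroup G, M.Normal ∧ N ≤ M ∧ IsPGroup p M := by
  -- the order of `G` modulo the core of `H` divides `r!`, so `H` modulo the core is a `p'`-group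
  have h1 : H.normalCore.index ∣ r.factorial := by
    have := index_ker (MulAction.toPermHom G (G ⧸ H))
    rw [← normalCore_eq_ker] at this
    rw [this, ← hH, index_eq_card, ← Nat.card_perm]
    exact card_subgroup_dvd_card _
  have h2 : H.normalCore.relIndex H ∣ (r - 1).factorial := by
    rw [← relIndex_mul_index H.normalCore_le, hH, ← Nat.mul_factorial_pred hr.ne_zero,
      mul_comm] at h1
    exact Nat.dvd_of_mul_dvd_mul_left hr.pos h1
  have h3 : ¬ p ∣ H.normalCore.relIndex H := fun h => by
    have := (hp.out.dvd_factorial).1 (h.trans h2)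
    have := hr.pos
    omega
  have hNC : N ≤ H.normalCore := by
    intro x hx
    obtain ⟨k, hk⟩ := IsPGroup.iff_orderOf.1 hN ⟨x, hx⟩
    rw [orderOf_mk] at hk
    have hco : (orderOf x).Coprime (H.normalCore.relIndex H) := by
      rw [hk]
      exact Nat.Coprime.pow_left _ (hp.out.coprime_iff_not_dvd.2 h3)
    refine mem_of_pow_mem_of_coprime hco ?_
    exact pow_index_mem (H.normalCore.subgroupOf H) ⟨x, hNH hx⟩
  exact exists_normal_isPGroup_of_normal H.normalCore hN hNC (H.normalCore_le.trans hHN)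

/-- If all primes in a chain from `P` to `K` are at most `p`, then the `p`-subgroup `P` lies in a
normal `p`-subgroup of `K`. -/
theorem PrimeChain.exists_normal_isPGroup [Finite G] {p : ℕ} [hp : Fact p.Prime]
    {P K : Subgroup G} (hP : IsPGroup p P) (h : PrimeChain ⊥ P K)
    (hmax : ∀ r : ℕ, r.Prime → r ∣ Nat.card K → r ≤ p) :
    ∃ M : Subgroup G, P ≤ M ∧ M ≤ K ∧ K ≤ normalizer (M : Set G) ∧ IsPGroup p M := by
  induction h with
  | refl => exact ⟨P, le_rfl, le_rfl, le_normalizer, hP⟩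
  | @tail X Y _ h2 ih =>
    obtain ⟨N, hPN, hNX, hXN, hN⟩ :=
      ih fun r hr h => hmax r hr (h.trans (card_dvd_of_le h2.1))
    have hr := h2.2.1
    obtain ⟨M, hM, hNM, hMp⟩ := exists_normal_isPGroup_of_index_prime (G := Y)
      (H := X.subgroupOf Y) (N := N.subgroupOf Y) (p := p) hr rfl
      (hmax _ hr (relIndex_dvd_card _ _)) hN.comap_subtype (comap_mono hNX) (by
        rw [← subgroupOf_normalizer_eq (hNX.trans h2.1)]
        exact comap_mono hXN)
    refine ⟨M.map Y.subtype, ?_, map_subtype_le M, ?_, hMp.map _⟩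
    · have := map_mono (f := Y.subtype) hNM
      rw [subgroupOf_map_subtype, inf_eq_left.2 (hNX.trans h2.1)] at this
      exact hPN.trans this
    · have := le_normalizer_map (H := M) Y.subtype
      rwa [normalizer_eq_top, ← MonoidHom.range_eq_map, range_subtype] at this

/-- In a v-supersoluble group, a Sylow subgroup for a prime `p` that is at least as large as all
prime divisors of the order is normal: each cyclic `p`-subgroup lies in a normal `p`-subgroup. -/
theorem IsVSupersoluble.normal_sylow [Finite G] (hG : IsVSupersoluble G) {p : ℕ}
    [hp : Fact p.Prime] (hmax : ∀ r : ℕ, r.Prime → r ∣ Nat.card G → r ≤ p) (P : Sylow p G) :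
    (P : Subgroup G).Normal := by
  have key : ∀ Q R : Sylow p G, (Q : Subgroup G) ≤ R := by
    intro Q R x hx
    obtain ⟨k, hk⟩ := IsPGroup.iff_orderOf.1 Q.isPGroup' ⟨x, hx⟩
    rw [orderOf_mk] at hk
    have h1 := isPrimeSubnormal_iff.1 (hG.isPrimeSubnormal_zpowers hp.out hk)
    obtain ⟨M, hxM, -, hM, hMp⟩ := h1.exists_normal_isPGroup
      (IsPGroup.of_card (by rw [Nat.card_zpowers, hk])) (by simpa using hmax)
    have := normal_of_top_le_normalizer hM
    exact hMp.le_sylow_of_normal R (hxM (mem_zpowers x))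
  have : Subsingleton (Sylow p G) := ⟨fun Q R => Sylow.ext ((key Q R).antisymm (key R Q))⟩
  exact P.normal_of_subsingleton

/-! ### Elements acting with `p`-power order on a `p`-subgroup -/

/-- Some `p`-power power of `g` centralizes `V`. If `g` normalizes `V`, this says that `g` induces
an automorphism of `p`-power order on `V`. -/
def ActsAsPElement (p : ℕ) (V : Subgroup G) (g : G) : Prop :=
  ∃ n : ℕ, ∀ v ∈ V, Commute (g ^ p ^ n) v

theorem ActsAsPElement.exists_le {p : ℕ} {V : Subgroup G} {g : G} (h : ActsAsPElement p V g) :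
    ∃ n : ℕ, ∀ m, n ≤ m → ∀ v ∈ V, Commute (g ^ p ^ m) v := by
  obtain ⟨n, hn⟩ := h
  refine ⟨n, fun m hm v hv => ?_⟩
  obtain ⟨k, rfl⟩ := Nat.exists_eq_add_of_le hm
  rw [pow_add, pow_mul]
  exact (hn v hv).pow_left _

theorem mem_of_pow_mem_of_pow_mem {D : Subgroup G} [D.Normal] {g : G} {a b : ℕ}
    (hab : a.Coprime b) (ha : g ^ a ∈ D) (hb : g ^ b ∈ D) : g ∈ D := by
  rw [← QuotientGroup.eq_one_iff] at *
  rw [QuotientGroup.mk_pow, ← orderOf_dvd_iff_pow_eq_one] at ha hb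
  exact orderOf_eq_one_iff.1 (Nat.eq_one_of_dvd_coprimes hab ha hb)

/-- Modulo `D = P C_G(P)`, where `P` is a normal Sylow `p`-subgroup, the group is a `p'`-group. So
an element acting with `p`-power order on `P` lies in `D`. -/
theorem ActsAsPElement.mem_sup_centralizer [Finite G] {p : ℕ} [hp : Fact p.Prime] {P : Sylow p G}
    (hP : (P : Subgroup G).Normal) {g : G} (h : ActsAsPElement p (P : Subgroup G) g) :
    g ∈ (P : Subgroup G) ⊔ centralizer ((P : Subgroup G) : Set G) := by
  obtain ⟨n, hn⟩ := h
  have h1 : ¬ p ∣ ((P : Subgroup G) ⊔ centralizer ((P : Subgroup G) : Set G)).index := fun h =>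
    P.not_dvd_index (h.trans (index_dvd_of_le le_sup_left))
  refine mem_of_pow_mem_of_pow_mem
    (Nat.Coprime.pow_left n ((hp.out.coprime_iff_not_dvd).2 h1)) ?_ (pow_index_mem _ g)
  exact mem_sup_right (mem_centralizer_iff.2 fun v hv => (hn v hv).eq.symm)

theorem commute_commutator_of_mem_normalizer {c x y : G} (hx : x ∈ normalizer (zpowers c : Set G))
    (hy : y ∈ normalizer (zpowers c : Set G)) : Commute ⁅x, y⁆ c := by
  let φ := normalizerMonoidHom (zpowers c)
  have h1 : φ ⁅(⟨x, hx⟩ : normalizer (zpowers c : Set G)), ⟨y, hy⟩⁆ = 1 := by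
    rw [map_commutatorElement, commutatorElement_eq_one_iff_mul_comm]
    apply (IsCyclic.mulAutMulEquiv (zpowers c)).injective
    rw [map_mul, map_mul, mul_comm]
  have h2 := congrArg Subtype.val (DFunLike.congr_fun h1 ⟨c, mem_zpowers c⟩)
  have h3 : ⁅x, y⁆ * c * ⁅x, y⁆⁻¹ = c := h2
  exact mul_inv_eq_iff_eq_mul.1 h3

theorem commute_pow_of_mem_normalizer [Finite G] {c x : G}
    (hx : x ∈ normalizer (zpowers c : Set G)) : Commute (x ^ (orderOf c).totient) c := by
  let φ := normalizerMonoidHom (zpowers c)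
  have h1 : φ (⟨x, hx⟩ ^ (orderOf c).totient) = 1 := by
    rw [map_pow, ← Nat.card_zpowers, ← IsCyclic.card_mulAut, pow_card_eq_one']
  have h2 := congrArg Subtype.val (DFunLike.congr_fun h1 ⟨c, mem_zpowers c⟩)
  have h3 : x ^ (orderOf c).totient * c * (x ^ (orderOf c).totient)⁻¹ = c := h2
  exact mul_inv_eq_iff_eq_mul.1 h3

/-- Stability: an element that acts trivially on `M / N` and with `p`-power order on the
`p`-group `N` acts with `p`-power order on `M`. -/
theorem ActsAsPElement.of_commutator_mem [Finite G] {p : ℕ} [Fact p.Prime] {N M : Subgroup G}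
    (hN : IsPGroup p N) {g : G} (hg : g ∈ normalizer (N : Set G)) (h : ActsAsPElement p N g)
    (hM : ∀ v ∈ M, ⁅g, v⁆ ∈ N) : ActsAsPElement p M g := by
  obtain ⟨n, hn⟩ := h
  obtain ⟨k, hk⟩ := IsPGroup.iff_card.1 hN
  have h1 : ∀ j : ℕ, ∀ v ∈ M, ⁅g ^ j, v⁆ ∈ N := by
    intro j v hv
    induction j with
    | zero => simp [commutatorElement_def]
    | succ j ih =>
      have : ⁅g ^ (j + 1), v⁆ = g * ⁅g ^ j, v⁆ * g⁻¹ * ⁅g, v⁆ := by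
        simp only [commutatorElement_def, pow_succ']
        group
      rw [this]
      exact N.mul_mem ((mem_normalizer_iff.1 hg _).1 ih) (hM v hv)
  refine ⟨n + k, fun v hv => ?_⟩
  set a := g ^ p ^ n with ha
  have hu := h1 (p ^ n) v hv
  rw [← ha] at hu
  have hcomm := hn _ hu
  set u := ⁅a, v⁆ with hu'
  have hav : a * v * a⁻¹ = u * v := by simp [hu', commutatorElement_def]
  have h2 : ∀ j : ℕ, a ^ j * v * (a ^ j)⁻¹ = u ^ j * v := by
    intro j
    induction j with
    | zero => simp
    | succ j ih =>
      calc a ^ (j + 1) * v * (a ^ (j + 1))⁻¹ = a * (a ^ j * v * (a ^ j)⁻¹) * a⁻¹ := by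
            rw [pow_succ']; group
        _ = a * u ^ j * v * a⁻¹ := by rw [ih]; group
        _ = u ^ j * (a * v * a⁻¹) := by rw [(hcomm.pow_right j).eq]; group
        _ = u ^ (j + 1) * v := by rw [hav, pow_succ]; group
  have h3 := h2 (p ^ k)
  have hu1 : u ^ p ^ k = 1 := by
    have := congrArg Subtype.val (pow_card_eq_one' (x := (⟨u, hu⟩ : N)))
    rwa [hk] at this
  rw [hu1, one_mul, ha, ← pow_mul, ← pow_add] at h3
  exact mul_inv_eq_iff_eq_mul.1 h3

theorem PrimeStep.normal_of_isPGroup [Finite G] {p : ℕ} [hp : Fact p.Prime] {T N M : Subgroup G}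
    (h : PrimeStep T N M) (hM : IsPGroup p M) :
    M ≤ normalizer (N : Set G) ∧ N.relIndex M = p := by
  obtain ⟨n, hn⟩ := IsPGroup.iff_card.1 hM
  have h1 : N.relIndex M = p := by
    have : N.relIndex M ∣ p ^ n := hn ▸ relIndex_dvd_card _ _
    exact (Nat.prime_dvd_prime_iff_eq h.2.1 hp.out).1 (h.2.1.dvd_of_dvd_pow this)
  refine ⟨(normal_subgroupOf_iff_le_normalizer h.1).1 (normal_of_index_eq_minFac_card ?_), h1⟩
  rw [← relIndex, h1, hn]
  rcases n with _ | n
  · have := relIndex_dvd_card N M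
    rw [h1, hn, pow_zero] at this
    exact absurd (Nat.dvd_one.1 this) hp.out.ne_one
  · exact (hp.out.pow_minFac n.succ_ne_zero).symm

/-- `T` acts on `M / N` through the cyclic group of automorphisms of a group of order `p`. -/
theorem PrimeStep.commutator_mem [Finite G] {p : ℕ} [hp : Fact p.Prime] {T N M : Subgroup G}
    (h : PrimeStep T N M) (hM : IsPGroup p M) {x y : G} (hx : x ∈ T) (hy : y ∈ T) :
    (∀ v ∈ M, ⁅⁅x, y⁆, v⁆ ∈ N) ∧ ∀ v ∈ M, ⁅x ^ (p - 1), v⁆ ∈ N := by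
  obtain ⟨hMN, hidx⟩ := h.normal_of_isPGroup hM
  -- all subgroups involved lie in the normalizer `L` of `N`, where `N` can be factored out
  let L := normalizer (N : Set G)
  let π : L →* L ⧸ N.subgroupOf L := QuotientGroup.mk' _
  have hπ : ∀ z : L, π z = 1 ↔ (z : G) ∈ N := fun z => by
    rw [QuotientGroup.mk'_apply, QuotientGroup.eq_one_iff, mem_subgroupOf]
  let x' : L := ⟨x, h.2.2.1 hx⟩
  let y' : L := ⟨y, h.2.2.1 hy⟩
  let M' := (M.subgroupOf L).map π
  have hcard : Nat.card M' = p := by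
    have h1 : Nat.card M' = (π.ker).relIndex (M.subgroupOf L) := (relIndex_ker _ _).symm
    rw [h1, QuotientGroup.ker_mk', relIndex_subgroupOf hMN, hidx]
  have hnorm : ∀ t, (ht : t ∈ T) →
      π ⟨t, h.2.2.1 ht⟩ ∈ normalizer (M' : Set (L ⧸ N.subgroupOf L)) := by
    intro t ht
    refine le_normalizer_map π (mem_map_of_mem π ?_)
    have : T.subgroupOf L ≤ normalizer ((M.subgroupOf L : Subgroup L) : Set L) :=
      (comap_mono h.2.2.2).trans (le_normalizer_comap _)
    exact this ht
  have key : ∀ c ∈ M', Commute ⁅π x', π y'⁆ c ∧ Commute (π x' ^ (p - 1)) c := by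
    intro c hc
    rcases eq_or_ne c 1 with rfl | hc1
    · exact ⟨Commute.one_right _, Commute.one_right _⟩
    have hord : orderOf c = p := by
      have : orderOf (⟨c, hc⟩ : M') ∣ p := hcard ▸ orderOf_dvd_natCard _
      rw [orderOf_mk] at this
      exact ((Nat.dvd_prime hp.out).1 this).resolve_left fun h => hc1 (orderOf_eq_one_iff.1 h)
    have hM' : M' = zpowers c := by
      symm
      refine eq_of_le_of_card_ge (zpowers_le.2 hc) ?_
      rw [Nat.card_zpowers, hord, hcard]
    have hx' := hnorm x hx
    have hy' := hnorm y hy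
    rw [hM'] at hx' hy'
    refine ⟨commute_commutator_of_mem_normalizer hx' hy', ?_⟩
    have := commute_pow_of_mem_normalizer hx'
    rwa [hord, Nat.totient_prime hp.out] at this
  constructor
  · intro v hv
    have h1 := (key (π ⟨v, hMN hv⟩) (mem_map_of_mem π hv)).1
    rw [← map_commutatorElement, ← commutatorElement_eq_one_iff_commute, ← map_commutatorElement,
      hπ] at h1
    exact h1
  · intro v hv
    have h1 := (key (π ⟨v, hMN hv⟩) (mem_map_of_mem π hv)).2
    rw [← map_pow, ← commutatorElement_eq_one_iff_commute, ← map_commutatorElement, hπ] at h1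
    exact h1

/-- If the `p`-group `S` has a `T`-invariant chain with prime indices, then `T` acts on `S`, up to
elements of `p`-power order, as an abelian group of exponent dividing `p - 1`. -/
theorem PrimeChain.actsAsPElement [Finite G] {p : ℕ} [hp : Fact p.Prime] {T S : Subgroup G}
    (h : PrimeChain T ⊥ S) (hS : IsPGroup p S) {x y : G} (hx : x ∈ T) (hy : y ∈ T) :
    ActsAsPElement p S ⁅x, y⁆ ∧ ActsAsPElement p S (x ^ (p - 1)) := by
  induction h with
  | refl =>
    refine ⟨⟨0, fun v hv => ?_⟩, ⟨0, fun v hv => ?_⟩⟩ <;>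
    · rw [mem_bot.1 hv]
      exact Commute.one_right _
  | @tail N M _ h2 ih =>
    have hN := hS.to_le h2.1
    obtain ⟨h3, h4⟩ := ih hN
    obtain ⟨h5, h6⟩ := h2.commutator_mem hS hx hy
    exact ⟨h3.of_commutator_mem hN (h2.2.2.1 (by
        rw [commutatorElement_def]
        exact T.mul_mem (T.mul_mem (T.mul_mem hx hy) (T.inv_mem hx)) (T.inv_mem hy))) h5,
      h4.of_commutator_mem hN (h2.2.2.1 (T.pow_mem hx _)) h6⟩

/-! ### Power automorphisms of `p`-groups -/

theorem exists_conj_eq_zpow {x v : G} (hx : x ∈ normalizer (zpowers v : Set G)) :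
    ∃ k : ℤ, x * v * x⁻¹ = v ^ k := by
  obtain ⟨k, hk⟩ := mem_zpowers_iff.1 ((mem_normalizer_iff.1 hx v).1 (mem_zpowers v))
  exact ⟨k, hk.symm⟩

theorem zpow_eq_zpow_iff_modEq_of_orderOf {p : ℕ} {v : G} (hv : orderOf v = p) {a b : ℤ} :
    v ^ a = v ^ b ↔ a ≡ b [ZMOD p] := by
  rw [zpow_eq_zpow_iff_modEq, hv]

/-- If `z` and `v` are commuting elements of order `p` that `x` raises to powers, and `x` also
normalizes `⟨zv⟩`, then the two exponents agree modulo `p`. -/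
theorem modEq_of_commute {p : ℕ} [hp : Fact p.Prime] {x z v : G} (hzv : Commute z v)
    (hz : orderOf z = p) (hv : orderOf v = p) {m k : ℤ} (hm : x * z * x⁻¹ = z ^ m)
    (hk : x * v * x⁻¹ = v ^ k) (hx : x ∈ normalizer (zpowers (z * v) : Set G)) :
    k ≡ m [ZMOD p] := by
  obtain ⟨l, hl⟩ := exists_conj_eq_zpow hx
  have h1 : z ^ (l - m) = v ^ (k - l) := by
    have h2 : z ^ m * v ^ k = z ^ l * v ^ l := by
      rw [← hzv.mul_zpow, ← hl, ← hm, ← hk]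
      group
    rw [sub_eq_neg_add l m, zpow_add, zpow_neg, zpow_sub, inv_mul_eq_iff_eq_mul, ← mul_assoc,
      eq_mul_inv_iff_mul_eq, h2]
  by_cases hd : (p : ℤ) ∣ k - l
  · have h3 : v ^ (k - l) = 1 := by
      rwa [← orderOf_dvd_iff_zpow_eq_one, hv]
    rw [h3, ← orderOf_dvd_iff_zpow_eq_one, hz] at h1
    have h4 : k - m = (l - m) + (k - l) := by ring
    exact (Int.modEq_iff_dvd.2 (h4 ▸ dvd_add h1 hd)).symm
  · -- here `v` is a power of `z`
    have hco : IsCoprime (k - l) (p : ℤ) := by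
      rw [isCoprime_comm]
      exact (Nat.prime_iff_prime_int.1 hp.out).coprime_iff_not_dvd.2 hd
    obtain ⟨a, b, hab⟩ := hco
    have hvz : v = z ^ ((l - m) * a) := by
      rw [zpow_mul, h1, ← zpow_mul]
      conv_lhs => rw [← zpow_one v, ← hab]
      rw [zpow_add, mul_comm a, mul_comm b, zpow_mul v p, zpow_natCast, ← hv, pow_orderOf_eq_one,
        one_zpow, mul_one]
    rw [← zpow_eq_zpow_iff_modEq_of_orderOf hv, ← hk]
    conv_lhs => rw [hvz]
    rw [← conj_zpow, hm, ← zpow_mul, mul_comm, zpow_mul, ← hvz]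

/-- An element normalizing all subgroups of the `p`-group `V` acts on each element of `V` as a
power map, with an exponent that is the same modulo `p` for all elements: it is determined by the
action on a central element of order `p`. -/
theorem exists_uniform_exponent [Finite G] {p : ℕ} [hp : Fact p.Prime] {V : Subgroup G}
    (hV : IsPGroup p V) {x : G} (hx : ∀ U ≤ V, x ∈ normalizer (U : Set G)) :
    ∃ m : ℤ, ∀ v ∈ V, ∀ k : ℤ, v ≠ 1 → x * v * x⁻¹ = v ^ k → k ≡ m [ZMOD p] := by
  -- the element of order `p` in the cyclic group generated by a nontrivial element of `V`
  have horder : ∀ v ∈ V, v ≠ 1 → ∃ n : ℕ, orderOf (v ^ n) = p := by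
    intro v hv h1
    obtain ⟨s, hs⟩ := IsPGroup.iff_orderOf.1 hV ⟨v, hv⟩
    rw [orderOf_mk] at hs
    have hp' : p ∣ orderOf v := by
      rw [hs]
      refine dvd_pow_self p fun h => h1 ?_
      rwa [h, pow_zero, orderOf_eq_one_iff] at hs
    refine ⟨orderOf v / p, ?_⟩
    rw [orderOf_pow_orderOf_div (orderOf_pos v).ne' hp']
  rcases subsingleton_or_nontrivial V with h | h
  · refine ⟨0, fun v hv k h1 => absurd ?_ h1⟩
    exact congrArg Subtype.val (Subsingleton.elim (⟨v, hv⟩ : V) 1)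
  have := hV.center_nontrivial
  obtain ⟨⟨⟨z, hzV⟩, hzc⟩, hz1⟩ := exists_ne (1 : center V)
  have hz1 : z ≠ 1 := fun h => hz1 (by simp [h])
  have hcomm : ∀ v ∈ V, Commute z v := fun v hv =>
    (congrArg Subtype.val (mem_center_iff.1 hzc ⟨v, hv⟩)).symm
  obtain ⟨n, hn⟩ := horder z hzV hz1
  obtain ⟨m, hm⟩ := exists_conj_eq_zpow (hx (zpowers (z ^ n)) (zpowers_le.2 (pow_mem hzV n)))
  refine ⟨m, fun v hv k h1 hk => ?_⟩
  obtain ⟨j, hj⟩ := horder v hv h1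
  refine modEq_of_commute ((hcomm v hv).pow_pow n j) hn hj hm ?_
    (hx _ (zpowers_le.2 (mul_mem (pow_mem hzV n) (pow_mem hv j))))
  rw [← conj_pow, hk, ← zpow_natCast, ← zpow_natCast, ← zpow_mul, ← zpow_mul, mul_comm]

/-- An element raising each element of the `p`-group `V` to an exponent that is `1` modulo `p` acts
with `p`-power order. -/
theorem actsAsPElement_of_conj_eq_zpow [Finite G] {p : ℕ} [hp : Fact p.Prime] {V : Subgroup G}
    (hV : IsPGroup p V) {g : G}
    (h : ∀ v ∈ V, ∃ k : ℤ, k ≡ 1 [ZMOD p] ∧ g * v * g⁻¹ = v ^ k) : ActsAsPElement p V g := by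
  obtain ⟨n, hn⟩ := IsPGroup.iff_card.1 hV
  refine ⟨n, fun v hv => ?_⟩
  obtain ⟨k, hk, hgv⟩ := h v hv
  have h1 : ∀ j : ℕ, g ^ j * v * (g ^ j)⁻¹ = v ^ (k ^ j) := by
    intro j
    induction j with
    | zero => simp
    | succ j ih =>
      calc g ^ (j + 1) * v * (g ^ (j + 1))⁻¹ = g * (g ^ j * v * (g ^ j)⁻¹) * g⁻¹ := by
            rw [pow_succ']; group
        _ = v ^ (k ^ (j + 1)) := by rw [ih, ← conj_zpow, hgv, ← zpow_mul, pow_succ']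
  have h2 : v ^ (k ^ p ^ n) = v := by
    have h3 : (p : ℤ) ^ (n + 1) ∣ k ^ p ^ n - 1 ^ p ^ n :=
      dvd_sub_pow_of_dvd_sub (Int.modEq_iff_dvd.1 hk.symm) n
    rw [one_pow] at h3
    have h4 : (orderOf v : ℤ) ∣ k ^ p ^ n - 1 := by
      refine dvd_trans ?_ h3
      have h5 : orderOf (⟨v, hv⟩ : V) ∣ p ^ n := hn ▸ orderOf_dvd_natCard _
      rw [orderOf_mk] at h5
      exact_mod_cast h5.trans (pow_dvd_pow p n.le_succ)
    conv_rhs => rw [← zpow_one v]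
    rw [zpow_eq_zpow_iff_modEq]
    exact (Int.modEq_iff_dvd.2 h4).symm
  have h3 := h1 (p ^ n)
  rw [h2] at h3
  exact mul_inv_eq_iff_eq_mul.1 h3

/-- Modulo elements of `p`-power order, an element normalizing all subgroups of `V` is central in
the group of automorphisms of `V` induced by its normalizer. -/
theorem actsAsPElement_commutator [Finite G] {p : ℕ} [hp : Fact p.Prime] {V : Subgroup G}
    (hV : IsPGroup p V) {x y : G} (hx : ∀ U ≤ V, x ∈ normalizer (U : Set G))
    (hy : y ∈ normalizer (V : Set G)) : ActsAsPElement p V ⁅x, y⁆ := by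
  obtain ⟨m, hm⟩ := exists_uniform_exponent hV hx
  refine actsAsPElement_of_conj_eq_zpow hV fun v hv => ?_
  rcases eq_or_ne v 1 with rfl | hv1
  · exact ⟨1, rfl, by simp [-commutatorElement_inv]⟩
  set w := y⁻¹ * v * y with hw
  have hwV : w ∈ V := by
    have := (mem_normalizer_iff.1 ((normalizer (V : Set G)).inv_mem hy) v).1 hv
    simpa [hw] using this
  have hw1 : w ≠ 1 := by
    intro h
    apply hv1
    rw [hw] at h
    calc v = y * (y⁻¹ * v * y) * y⁻¹ := by group
      _ = 1 := by rw [h]; simp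
  have hvw : y * w * y⁻¹ = v := by rw [hw]; group
  have hpow : ∀ u ∈ V, zpowers u ≤ V := fun u hu => zpowers_le.2 hu
  obtain ⟨k, hk⟩ := exists_conj_eq_zpow (hx _ (hpow v hv))
  obtain ⟨l, hl⟩ := exists_conj_eq_zpow (hx _ (hpow w hwV))
  obtain ⟨i, hi⟩ := exists_conj_eq_zpow 
    ((normalizer (zpowers w : Set G)).inv_mem (hx _ (hpow w hwV)))
  rw [inv_inv] at hi
  have hli : l * i ≡ 1 [ZMOD p] := by
    have h1 : w ^ (l * i) = w := by
      rw [zpow_mul, ← hl, conj_zpow, ← hi]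
      group
    conv_rhs at h1 => rw [← zpow_one w]
    rw [zpow_eq_zpow_iff_modEq] at h1
    refine h1.of_dvd ?_
    have := hV.dvd_orderOf (g := ⟨w, hwV⟩) (by simpa using hw1)
    rw [orderOf_mk] at this
    exact_mod_cast this
  refine ⟨k * i, ?_, ?_⟩
  · refine Int.ModEq.trans ?_ hli
    exact ((hm v hv k hv1 hk).trans (hm w hwV l hw1 hl).symm).mul_right i
  · calc ⁅x, y⁆ * v * ⁅x, y⁆⁻¹ = x * (y * (x⁻¹ * (y⁻¹ * v * y) * x) * y⁻¹) * x⁻¹ := by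
          rw [commutatorElement_def]; group
      _ = x * (y * w ^ i * y⁻¹) * x⁻¹ := by rw [← hw, hi]
      _ = v ^ (k * i) := by rw [← conj_zpow, hvw, ← conj_zpow, hk, ← zpow_mul]

theorem actsAsPElement_pow [Finite G] {p : ℕ} [hp : Fact p.Prime] {V : Subgroup G}
    (hV : IsPGroup p V) {x : G} (hx : ∀ U ≤ V, x ∈ normalizer (U : Set G)) :
    ActsAsPElement p V (x ^ (p - 1)) := by
  obtain ⟨n, hn⟩ := IsPGroup.iff_card.1 hV
  refine ⟨n, fun v hv => ?_⟩
  have h1 := commute_pow_of_mem_normalizer (hx _ (zpowers_le.2 hv))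
  have h2 : orderOf (⟨v, hv⟩ : V) ∣ p ^ (n + 1) :=
    (hn ▸ _root_.orderOf_dvd_natCard (⟨v, hv⟩ : V)).trans (pow_dvd_pow p n.le_succ)
  rw [orderOf_mk] at h2
  have h3 := Nat.totient_dvd_of_dvd h2
  rw [Nat.totient_prime_pow_succ hp.out, mul_comm] at h3
  obtain ⟨c, hc⟩ := h3
  rw [← pow_mul, hc, pow_mul]
  exact h1.pow_left c

/-! ### Invariant chains from commuting automorphisms of exponent dividing `p - 1` -/

open Polynomial in
/-- `X ^ p - X` splits over the field with `p` elements, so an operator `f` with `f ^ p = f` has an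
eigenvector. -/
theorem exists_eigenvector {p : ℕ} [hp : Fact p.Prime] {V : Type*} [AddCommGroup V]
    [Module (ZMod p) V] [Nontrivial V] [Finite V] (f : Module.End (ZMod p) V) (hf : f ^ p = f) :
    ∃ (a : ZMod p) (v : V), v ≠ 0 ∧ f v = a • v := by
  have hne : (X ^ p - X : (ZMod p)[X]) ≠ 0 := FiniteField.X_pow_card_sub_X_ne_zero _ hp.out.one_lt
  have haev : aeval f (X ^ p - X : (ZMod p)[X]) = 0 := by simp [hf]
  have hint : IsIntegral (ZMod p) f := isAlgebraic_iff_isIntegral.1 ⟨_, hne, haev⟩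
  have hsplit : (X ^ p - X : (ZMod p)[X]).Splits := by
    have := (FiniteField.isSplittingField_sub (ZMod p) (ZMod p)).splits
    simpa [ZMod.card] using this
  have hsplit' : (minpoly (ZMod p) f).Splits := hsplit.of_dvd hne (minpoly.dvd _ _ haev)
  obtain ⟨a, ha⟩ := hsplit'.exists_eval_eq_zero (minpoly.degree_pos hint).ne'
  obtain ⟨v, hv⟩ := (Module.End.hasEigenvalue_of_isRoot ha).exists_hasEigenvector
  exact ⟨a, v, hv.2, hv.apply_eq_smul⟩

theorem exists_map_eq_nsmul {p : ℕ} [hp : Fact p.Prime] {V : Type*} [AddCommGroup V]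
    [Nontrivial V] [Finite V] (hexp : ∀ v : V, p • v = 0) (f : V →+ V)
    (hf : ∀ v, f^[p - 1] v = v) : ∃ (a : ℕ) (v : V), v ≠ 0 ∧ f v = a • v := by
  have hfp : ∀ v, f^[p] v = f v := fun v => by
    have := Function.iterate_succ_apply' f (p - 1) v
    rwa [Nat.succ_eq_add_one, Nat.sub_add_cancel hp.out.one_le, hf] at this
  let _ : Module (ZMod p) V := AddCommGroup.zmodModule hexp
  obtain ⟨a, v, hv, hav⟩ := exists_eigenvector (f.toZModLinearMap p : Module.End (ZMod p) V) (by
    ext v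
    rw [Module.End.pow_apply]
    exact hfp v)
  refine ⟨a.val, v, hv, ?_⟩
  rw [← Nat.cast_smul_eq_nsmul (ZMod p), ZMod.natCast_zmod_val]
  exact hav

theorem exists_map_eq_pow {p : ℕ} [hp : Fact p.Prime] {A : Type*} [CommGroup A] [Nontrivial A]
    [Finite A] (hexp : ∀ v : A, v ^ p = 1) (f : A →* A) (hf : ∀ v, f^[p - 1] v = v) :
    ∃ (a : ℕ) (v : A), v ≠ 1 ∧ f v = v ^ a :=
  exists_map_eq_nsmul (V := Additive A) hexp (MonoidHom.toAdditive f) hf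

theorem exists_conj_eq_pow [Finite G] {p : ℕ} [hp : Fact p.Prime] {N : Subgroup G} [N.Normal]
    (hN : N ≠ ⊥) (hcomm : ∀ u ∈ N, ∀ v ∈ N, Commute u v) (hexp : ∀ v ∈ N, v ^ p = 1) {x : G}
    (hx : ∀ v ∈ N, Commute (x ^ (p - 1)) v) :
    ∃ (a : ℕ), ∃ v ∈ N, v ≠ 1 ∧ x * v * x⁻¹ = v ^ a := by
  let _ : CommGroup N :=
    { (inferInstance : Group N) with mul_comm := fun u v => Subtype.ext (hcomm u u.2 v v.2) }
  have : Nontrivial N := (nontrivial_iff_ne_bot N).2 hN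
  have hit : ∀ (j : ℕ) (v : N),
      (((MulAut.conjNormal x : MulAut N).toMonoidHom^[j] v : N) : G) = x ^ j * v * (x ^ j)⁻¹ := by
    intro j v
    induction j with
    | zero => simp
    | succ j ih =>
      rw [Function.iterate_succ_apply', MulEquiv.coe_toMonoidHom, MulAut.conjNormal_apply]
      rw [MulEquiv.coe_toMonoidHom] at ih
      rw [ih, pow_succ']
      group
  obtain ⟨a, v, hv, hav⟩ := exists_map_eq_pow (p := p) (fun v : N => Subtype.ext (hexp v v.2))
    (MulAut.conjNormal x : MulAut N).toMonoidHom fun v => Subtype.ext (by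
      rw [hit, (hx v v.2).eq, mul_inv_cancel_right])
  exact ⟨a, v, v.2, fun h => hv (Subtype.ext h), congrArg Subtype.val hav⟩

/-- A minimal normal subgroup of exponent `p` on which `G` acts as an abelian group of exponent
dividing `p - 1` has order `p`: the eigenspaces of each element are normal in `G`, so every
element acts as a scalar. -/
theorem card_eq_of_minimal_normal [Finite G] {p : ℕ} [hp : Fact p.Prime] {N : Subgroup G} [N.Normal]
    (hN : N ≠ ⊥) (hmin : ∀ L : Subgroup G, L.Normal → L ≤ N → L ≠ ⊥ → L = N)
    (hcomm : ∀ u ∈ N, ∀ v ∈ N, Commute u v) (hexp : ∀ v ∈ N, v ^ p = 1)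
    (h1 : ∀ x y : G, ∀ v ∈ N, Commute ⁅x, y⁆ v) (h2 : ∀ x : G, ∀ v ∈ N, Commute (x ^ (p - 1)) v) :
    Nat.card N = p := by
  have hconj : ∀ y : G, ∀ v ∈ N, y * v * y⁻¹ ∈ N := fun y v hv => Normal.conj_mem ‹_› v hv y
  have key : ∀ x : G, ∃ a : ℕ, ∀ v ∈ N, x * v * x⁻¹ = v ^ a := by
    intro x
    obtain ⟨a, v, hv, hv1, hav⟩ := exists_conj_eq_pow hN hcomm hexp (h2 x)
    let E : Subgroup G :=
      { carrier := {u | u ∈ N ∧ x * u * x⁻¹ = u ^ a}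
        one_mem' := ⟨N.one_mem, by simp⟩
        mul_mem' := fun {u w} hu hw => ⟨N.mul_mem hu.1 hw.1, by
          rw [(hcomm u hu.1 w hw.1).mul_pow, ← hu.2, ← hw.2]; group⟩
        inv_mem' := fun {u} hu => ⟨N.inv_mem hu.1, by
          rw [inv_pow, ← hu.2]; group⟩ }
    have hE : E.Normal := by
      refine ⟨fun u hu y => ⟨hconj y u hu.1, ?_⟩⟩
      have hw := h1 x y _ (pow_mem (hconj y u hu.1) a)
      calc x * (y * u * y⁻¹) * x⁻¹ = ⁅x, y⁆ * (y * (x * u * x⁻¹) * y⁻¹) * ⁅x, y⁆⁻¹ := by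
            rw [commutatorElement_def]; group
        _ = ⁅x, y⁆ * (y * u * y⁻¹) ^ a * ⁅x, y⁆⁻¹ := by rw [hu.2, conj_pow]
        _ = (y * u * y⁻¹) ^ a := by rw [hw.eq, mul_inv_cancel_right]
    have hEN : E = N := hmin E hE (fun u hu => hu.1) fun h => hv1 (by
      have : v ∈ E := ⟨hv, hav⟩
      rwa [h, mem_bot] at this)
    exact ⟨a, fun u hu => ((hEN ▸ hu : u ∈ E)).2⟩
  obtain ⟨v, hv, hv1⟩ := ne_bot_iff_exists_ne_one.1 hN |>.elim fun v hv =>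
    (⟨v, v.2, fun h => hv (Subtype.ext h)⟩ : ∃ v ∈ N, v ≠ 1)
  have hz : (zpowers v).Normal := by
    refine ⟨fun u hu y => ?_⟩
    obtain ⟨a, ha⟩ := key y
    rw [ha u ((zpowers_le.2 hv) hu)]
    exact pow_mem hu a
  rw [← hmin _ hz (zpowers_le.2 hv) (fun h => hv1 (zpowers_eq_bot.1 h)), Nat.card_zpowers]
  exact orderOf_eq_prime (hexp v hv) hv1

theorem map_sup_centralizer_le (S : Subgroup G) (f : G →* G') :
    (S ⊔ centralizer (S : Set G)).map f ≤ S.map f ⊔ centralizer (S.map f : Set G') := by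
  rw [Subgroup.map_sup]
  exact sup_le_sup_left (map_centralizer_le_centralizer_image _ f) _

/-- If `G` acts on its normal `p`-subgroup `S`, modulo `S C_G(S)`, as an abelian group of exponent
dividing `p - 1`, then `S` has a chain of normal subgroups of `G` with indices `p`. -/
theorem primeChain_top_of_mem_sup_centralizer {p : ℕ} [hp : Fact p.Prime] (n : ℕ) :
    ∀ {G : Type*} [Group G] [Finite G] (S : Subgroup G) [S.Normal], Nat.card S = n →
      IsPGroup p S →
      (∀ x y : G, ⁅x, y⁆ ∈ S ⊔ centralizer (S : Set G)) →
      (∀ x : G, x ^ (p - 1) ∈ S ⊔ centralizer (S : Set G)) → PrimeChain ⊤ ⊥ S := by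
  induction n using Nat.strong_induction_on with
  | _ n ih =>
  intro G _ _ S _ hn hS h1 h2
  rcases eq_or_ne S ⊥ with rfl | hne
  · exact .refl
  -- a minimal normal subgroup of `G` inside the center of `S`
  have hnt : Nontrivial S := (nontrivial_iff_ne_bot S).2 hne
  have hcn := hS.center_nontrivial
  obtain ⟨N, hNm⟩ :=
    (Set.toFinite {N : Subgroup G | N.Normal ∧ N ≠ ⊥ ∧ N ≤ (center S).map S.subtype}).exists_minimal
      ⟨(center S).map S.subtype, inferInstance, fun h => by
        rw [map_eq_bot_iff_of_injective _ S.subtype_injective] at h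
        exact (nontrivial_iff_ne_bot _).1 hcn h, le_rfl⟩
  have hNn : N.Normal := hNm.prop.1
  have hNb : N ≠ ⊥ := hNm.prop.2.1
  have hNZ := hNm.prop.2.2
  have hNS : N ≤ S := hNZ.trans (map_subtype_le _)
  have hmin : ∀ L : Subgroup G, L.Normal → L ≤ N → L ≠ ⊥ → L = N := fun L hL hLN hLb =>
    hLN.antisymm (hNm.le_of_le ⟨hL, hLb, hLN.trans hNZ⟩ hLN)
  have hcS : ∀ s ∈ S, ∀ v ∈ N, Commute s v := by
    intro s hs v hv
    obtain ⟨z, hz, rfl⟩ := mem_map.1 (hNZ hv)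
    exact congrArg Subtype.val (mem_center_iff.1 hz ⟨s, hs⟩)
  have hD : ∀ d ∈ S ⊔ centralizer (S : Set G), ∀ v ∈ N, Commute d v := by
    intro d hd v hv
    have : S ⊔ centralizer (S : Set G) ≤ centralizer {v} := by
      refine sup_le (fun s hs => ?_) fun c hc => ?_
      · exact mem_centralizer_singleton_iff.2 (hcS s hs v hv).eq
      · exact mem_centralizer_singleton_iff.2 (mem_centralizer_iff.1 hc v (hNS hv)).symm
    exact mem_centralizer_singleton_iff.1 (this hd)
  have hcomm : ∀ u ∈ N, ∀ v ∈ N, Commute u v := fun u hu => hcS u (hNS hu)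
  -- the elements of order dividing `p` form all of `N`
  have hexp : ∀ v ∈ N, v ^ p = 1 := by
    let E : Subgroup G :=
      { carrier := {u | u ∈ N ∧ u ^ p = 1}
        one_mem' := ⟨N.one_mem, by simp⟩
        mul_mem' := fun {u w} hu hw => ⟨N.mul_mem hu.1 hw.1, by
          rw [(hcomm u hu.1 w hw.1).mul_pow, hu.2, hw.2, one_mul]⟩
        inv_mem' := fun {u} hu => ⟨N.inv_mem hu.1, by rw [inv_pow, hu.2, inv_one]⟩ }
    have hE : E.Normal := ⟨fun u hu y => ⟨hNn.conj_mem u hu.1 y, by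
      rw [conj_pow, hu.2, mul_one, mul_inv_cancel]⟩⟩
    have hEb : E ≠ ⊥ := by
      have hp' : p ∣ Nat.card N := (hS.to_le hNS).card_eq_or_dvd.resolve_left fun h =>
        hNb (card_eq_one.1 h)
      obtain ⟨v, hv⟩ := exists_prime_orderOf_dvd_card' p hp'
      intro h
      have hvE : (v : G) ∈ E :=
        ⟨v.2, by exact_mod_cast congrArg Subtype.val (hv ▸ pow_orderOf_eq_one v : v ^ p = 1)⟩
      rw [h, mem_bot] at hvE
      rw [← orderOf_coe, hvE, orderOf_one] at hv
      exact hp.out.one_lt.ne hv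
    have hEN := hmin E hE (fun u hu => hu.1) hEb
    exact fun v hv => ((hEN ▸ hv : v ∈ E)).2
  have hcard : Nat.card N = p := card_eq_of_minimal_normal hNb hmin hcomm hexp
    (fun x y => hD _ (h1 x y)) fun x => hD _ (h2 x)
  have hstep : PrimeStep ⊤ ⊥ N := ⟨bot_le, by rw [relIndex_bot_left, hcard]; exact hp.out,
    le_normalizer_of_normal _ _, le_normalizer_of_normal _ _⟩
  let f := QuotientGroup.mk' N
  have hf : Function.Surjective f := QuotientGroup.mk'_surjective N
  have hSn : (S.map f).Normal := Normal.map ‹_› f hf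
  have hlt : Nat.card (S.map f) < n := by
    have h3 := relIndex_mul_relIndex ⊥ N S bot_le hNS
    rw [relIndex_bot_left, relIndex_bot_left, hcard, hn] at h3
    have h4 : Nat.card (S.map f) = N.relIndex S := by
      rw [← relIndex_ker, QuotientGroup.ker_mk']
    have h5 : 0 < Nat.card (S.map f) := Nat.card_pos
    rw [h4] at h5 ⊢
    rw [← h3]
    exact lt_mul_of_one_lt_left h5 hp.out.one_lt
  have hch := ih _ hlt (S.map f) rfl (hS.map f)
    (fun x y => by
      obtain ⟨x, rfl⟩ := hf x
      obtain ⟨y, rfl⟩ := hf y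
      rw [← map_commutatorElement]
      exact map_sup_centralizer_le S f (mem_map_of_mem f (h1 x y)))
    (fun x => by
      obtain ⟨x, rfl⟩ := hf x
      rw [← map_pow]
      exact map_sup_centralizer_le S f (mem_map_of_mem f (h2 x)))
  have hch' := hch.comap hf
  have hk : f.ker = N := QuotientGroup.ker_mk' N
  rw [comap_top, comap_map_eq, MonoidHom.comap_bot, hk, sup_eq_left.2 hNS] at hch'
  exact .head hstep hch'

/-- `T` acts on `S`, modulo `S C_G(S)`, as an abelian group of exponent dividing `p - 1`. -/
def ActsAbelian (p : ℕ) (S T : Subgroup G) : Prop :=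
  (∀ x ∈ T, ∀ y ∈ T, ⁅x, y⁆ ∈ S ⊔ centralizer (S : Set G)) ∧
    ∀ x ∈ T, x ^ (p - 1) ∈ S ⊔ centralizer (S : Set G)

theorem ActsAbelian.sup [Finite G] {p : ℕ} {S T : Subgroup G} [S.Normal] (h : ActsAbelian p S T) :
    ActsAbelian p S (T ⊔ S) := by
  let D := S ⊔ centralizer (S : Set G)
  let π := QuotientGroup.mk' D
  have hker : ∀ g, π g = 1 ↔ g ∈ D := fun g => QuotientGroup.eq_one_iff g
  have hT : ∀ x ∈ T ⊔ S, ∃ t ∈ T, π x = π t := by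
    intro x hx
    rw [← SetLike.mem_coe, mul_normal] at hx
    obtain ⟨t, ht, s, hs, rfl⟩ := hx
    refine ⟨t, ht, ?_⟩
    rw [map_mul, (hker s).2 (mem_sup_left hs), mul_one]
  constructor
  · intro x hx y hy
    obtain ⟨t, ht, hxt⟩ := hT x hx
    obtain ⟨u, hu, hyu⟩ := hT y hy
    rw [← hker, map_commutatorElement, hxt, hyu, ← map_commutatorElement, hker]
    exact h.1 t ht u hu
  · intro x hx
    obtain ⟨t, ht, hxt⟩ := hT x hx
    rw [← hker, map_pow, hxt, ← map_pow, hker]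
    exact h.2 t ht

theorem ActsAbelian.primeChain [Finite G] {p : ℕ} [hp : Fact p.Prime] {S T : Subgroup G}
    [S.Normal] (hS : IsPGroup p S) (h : ActsAbelian p S T) : PrimeChain T ⊥ S := by
  obtain ⟨h1, h2⟩ := h.sup
  let L := T ⊔ S
  have hSL : S ≤ L := le_sup_right
  have hmem : ∀ z : L, (z : G) ∈ S ⊔ centralizer (S : Set G) →
      z ∈ S.subgroupOf L ⊔ centralizer (S.subgroupOf L : Set L) := by
    intro z hz
    rw [← SetLike.mem_coe, normal_mul] at hz
    obtain ⟨s, hs, c, hc, hsc⟩ := hz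
    have hcL : c ∈ L := by
      have : c = s⁻¹ * z := by rw [← hsc]; simp
      exact this ▸ L.mul_mem (L.inv_mem (hSL hs)) z.2
    have : z = ⟨s, hSL hs⟩ * ⟨c, hcL⟩ := Subtype.ext hsc.symm
    rw [this]
    refine mul_mem (mem_sup_left hs) (mem_sup_right (mem_centralizer_iff.2 fun w hw => ?_))
    exact Subtype.ext (mem_centralizer_iff.1 hc w hw)
  have h3 := primeChain_top_of_mem_sup_centralizer (p := p) _ (S.subgroupOf L) rfl
    hS.comap_subtype (fun x y => hmem _ (h1 x x.2 y y.2)) (fun x => hmem _ (h2 x x.2))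
  have h4 := h3.map L.subtype
  rw [← MonoidHom.range_eq_map, range_subtype, Subgroup.map_bot, subgroupOf_map_subtype,
    inf_eq_left.2 hSL] at h4
  exact h4.mono le_sup_left

/-! ### Sylow subgroups of msp-permutable products -/

theorem coe_sup_of_mul_comm {H K : Subgroup G}
    (h : (H : Set G) * (K : Set G) = (K : Set G) * (H : Set G)) :
    ((H ⊔ K : Subgroup G) : Set G) = (H : Set G) * (K : Set G) := by
  let L : Subgroup G :=
    { carrier := (H : Set G) * (K : Set G)
      one_mem' := ⟨1, H.one_mem, 1, K.one_mem, mul_one 1⟩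
      mul_mem' := fun {a b} ha hb => by
        have : a * b ∈ ((H : Set G) * K) * ((H : Set G) * K) := Set.mul_mem_mul ha hb
        rwa [mul_assoc, ← mul_assoc (K : Set G), ← h, mul_assoc, coe_mul_coe, ← mul_assoc,
          coe_mul_coe] at this
      inv_mem' := fun {a} ha => by
        have : a⁻¹ ∈ ((H : Set G) * K)⁻¹ := Set.inv_mem_inv.2 ha
        rwa [mul_inv_rev, inv_coe_set, inv_coe_set, ← h] at this }
  have hL : H ⊔ K = L := by
    refine le_antisymm (sup_le ?_ ?_) ?_
    · exact fun x hx => ⟨x, hx, 1, K.one_mem, mul_one x⟩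
    · exact fun x hx => ⟨1, H.one_mem, x, hx, one_mul x⟩
    · rintro _ ⟨x, hx, y, hy, rfl⟩
      exact mul_mem_sup hx hy
  rw [hL]
  rfl

theorem subset_mul_of_relIndex_le [Finite G] {X M Z : Subgroup G} (hM : M ≤ Z)
    (h : X.relIndex Z ≤ X.relIndex M) : (Z : Set G) ⊆ (M : Set G) * (X : Set G) := by
  let φ : M ⧸ X.subgroupOf M → Z ⧸ X.subgroupOf Z :=
    Quotient.map' (Subgroup.inclusion hM) fun a b hab => by
      rw [QuotientGroup.leftRel_apply, mem_subgroupOf] at hab ⊢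
      exact hab
  have hinj : Function.Injective φ := by
    intro a b
    induction a using QuotientGroup.induction_on with | H a => ?_
    induction b using QuotientGroup.induction_on with | H b => ?_
    intro hab
    exact QuotientGroup.eq.2 (QuotientGroup.eq.1 hab :)
  have hsurj := (Function.Injective.bijective_of_nat_card_le hinj h).2
  intro z hz
  obtain ⟨m, hm⟩ := hsurj (QuotientGroup.mk ⟨z, hz⟩)
  induction m using QuotientGroup.induction_on with | H m => ?_
  have h1 : (m : G)⁻¹ * z ∈ X := (QuotientGroup.eq.1 hm :)
  exact ⟨m, m.2, _, h1, by simp⟩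

theorem mul_comm_eq_univ {A B : Subgroup G} (h : (A : Set G) * (B : Set G) = Set.univ) :
    (B : Set G) * (A : Set G) = Set.univ := by
  have := congrArg (·⁻¹) h
  simpa [mul_inv_rev] using this

/-- If `G = AB`, then suitable Sylow `p`-subgroups of `A` and `B` have a Sylow `p`-subgroup of `G`
as their product. -/
theorem exists_sylow_mul [Finite G] {A B : Subgroup G} (p : ℕ) [hp : Fact p.Prime]
    (h : (A : Set G) * (B : Set G) = Set.univ) :
    ∃ (P : Sylow p A) (R : Sylow p B) (Q : Sylow p G), ((Q : Subgroup G) : Set G) =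
      ((P : Subgroup A).map A.subtype : Set G) * ((R : Subgroup B).map B.subtype : Set G) := by
  let P₀ : Sylow p A := default
  let R₀ : Sylow p B := default
  obtain ⟨Q₁, hQ₁⟩ := (P₀.isPGroup'.map A.subtype).exists_le_sylow
  obtain ⟨Q₂, hQ₂⟩ := (R₀.isPGroup'.map B.subtype).exists_le_sylow
  obtain ⟨g, hg⟩ := MulAction.exists_smul_eq G Q₁ Q₂
  obtain ⟨b, hb, a, ha, hba⟩ : g ∈ (B : Set G) * (A : Set G) := by
    rw [mul_comm_eq_univ h]
    trivial
  have hba : b * a = g := hba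
  -- a common Sylow subgroup of `G` above conjugates of `P₀` and `R₀`
  let Q := a • Q₁
  have hQ : Q = b⁻¹ • Q₂ := by rw [← hg, ← hba, mul_smul, inv_smul_smul]
  let P := (⟨a, ha⟩ : A) • P₀
  let R := (⟨b, hb⟩ : B)⁻¹ • R₀
  have hP : (P : Subgroup A).map A.subtype ≤ Q := by
    rintro _ ⟨_, ⟨x, hx, rfl⟩, rfl⟩
    exact ⟨x, hQ₁ (mem_map_of_mem _ hx), rfl⟩
  have hR : (R : Subgroup B).map B.subtype ≤ Q := by
    rw [hQ]
    rintro _ ⟨_, ⟨x, hx, rfl⟩, rfl⟩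
    exact ⟨x, hQ₂ (mem_map_of_mem _ hx), rfl⟩
  refine ⟨P, R, Q, Set.Subset.antisymm ?_ ?_⟩
  · refine subset_mul_of_relIndex_le hP ?_
    set P' := (P : Subgroup A).map A.subtype with hP'
    set R' := (R : Subgroup B).map B.subtype with hR'
    have cP : Nat.card P' = p ^ (Nat.card A).factorization p := by
      rw [hP', card_map_of_injective A.subtype_injective, P.card_eq_multiplicity]
    have cR : Nat.card R' = p ^ (Nat.card B).factorization p := by
      rw [hR', card_map_of_injective B.subtype_injective, R.card_eq_multiplicity]
    have cQ := Q.card_eq_multiplicity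
    have hcard : Nat.card G * Nat.card (A ⊓ B : Subgroup G) = Nat.card A * Nat.card B := by
      have h1 : B.relIndex ⊤ = B.relIndex A := relIndex_eq_of_subset_mul le_top (by simp [h])
      rw [relIndex_top_right] at h1
      have h2 := relIndex_mul_relIndex ⊥ (A ⊓ B) A bot_le inf_le_left
      rw [relIndex_bot_left, relIndex_bot_left, inf_relIndex_left] at h2
      rw [← h2, ← B.card_mul_index, h1]
      ring
    have hval : (Nat.card G).factorization p + (Nat.card (A ⊓ B : Subgroup G)).factorization p =
        (Nat.card A).factorization p + (Nat.card B).factorization p := by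
      rw [← Finsupp.add_apply, ← Finsupp.add_apply,
        ← Nat.factorization_mul Nat.card_pos.ne' Nat.card_pos.ne',
        ← Nat.factorization_mul Nat.card_pos.ne' Nat.card_pos.ne', hcard]
    have hP'A : P' ≤ A := map_subtype_le _
    have hR'B : R' ≤ B := map_subtype_le _
    obtain ⟨j, hj⟩ := IsPGroup.iff_card.1 ((P.isPGroup'.map A.subtype).to_le
      (inf_le_left : P' ⊓ R' ≤ P'))
    have hjle : j ≤ (Nat.card (A ⊓ B : Subgroup G)).factorization p := by
      rw [← hp.out.pow_dvd_iff_le_factorization Nat.card_pos.ne', ← hj]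
      exact card_dvd_of_le (inf_le_inf hP'A hR'B)
    have e1 := relIndex_mul_relIndex ⊥ (P' ⊓ R') P' bot_le inf_le_left
    rw [relIndex_bot_left, relIndex_bot_left, inf_relIndex_left, hj, cP] at e1
    have e2 := relIndex_mul_relIndex ⊥ R' Q bot_le hR
    rw [relIndex_bot_left, relIndex_bot_left, cR, cQ] at e2
    have e3 : p ^ (Nat.card (A ⊓ B : Subgroup G)).factorization p * R'.relIndex Q =
        p ^ j * R'.relIndex P' := by
      apply Nat.eq_of_mul_eq_mul_left (pow_pos hp.out.pos ((Nat.card B).factorization p))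
      rw [e1, ← pow_add, add_comm ((Nat.card B).factorization p), ← hval, pow_add, ← e2]
      ring
    refine Nat.le_of_mul_le_mul_left ?_ (pow_pos hp.out.pos
      ((Nat.card (A ⊓ B : Subgroup G)).factorization p))
    rw [e3]
    exact Nat.mul_le_mul_right _ (Nat.pow_le_pow_right hp.out.pos hjle)
  · rintro _ ⟨x, hx, y, hy, rfl⟩
    exact mul_mem (hP hx) (hR hy)

/-- A subgroup that contains a Sylow subgroup for every prime is the whole group. -/
theorem eq_top_of_sylow_le [Finite G] {K : Subgroup G}
    (h : ∀ q : ℕ, q.Prime → ∃ Q : Sylow q G, (Q : Subgroup G) ≤ K) : K = ⊤ := by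
  rw [← index_eq_one]
  by_contra hne
  obtain ⟨q, hq, hdvd⟩ := Nat.exists_prime_and_dvd hne
  have := Fact.mk hq
  obtain ⟨Q, hQ⟩ := h q hq
  exact Q.not_dvd_index (hdvd.trans (index_dvd_of_le hQ))

/-- If a `q`-group `X` and a `p`-group `V` are mutually permutable and `q < p`, then `X`
normalizes every subgroup of `V`: a chain from `1` to `X` shows that `V` is normal in `XV`, and
then `U = V ∩ XU` is normal in `XU` for `U ≤ V`. -/
theorem MutuallyPermutable.le_normalizer [Finite G] {p q : ℕ} [hp : Fact p.Prime]
    [hq : Fact q.Prime] (hqp : q < p) {X V : Subgroup G} (hX : IsPGroup q X) (hV : IsPGroup p V)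
    (h : MutuallyPermutable X V) {U : Subgroup G} (hU : U ≤ V) : X ≤ normalizer (U : Set G) := by
  have hdisj : ∀ x ∈ X, x ∈ V → x = 1 := fun x hx hxV =>
    disjoint_def.1 (IsPGroup.disjoint_of_ne q p hqp.ne X V hX hV) hx hxV
  have hcoe : ∀ Y ≤ X, ((V ⊔ Y : Subgroup G) : Set G) = (Y : Set G) * (V : Set G) := fun Y hY => by
    rw [sup_comm]
    exact coe_sup_of_mul_comm (h.1 Y hY)
  have hidx : ∀ Y Z : Subgroup G, Z ≤ X → (V ⊔ Y).relIndex (V ⊔ Z) = (V ⊔ Y).relIndex Z := by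
    intro Y Z hZ
    refine relIndex_eq_of_subset_mul le_sup_right ?_
    rw [hcoe Z hZ]
    exact Set.mul_subset_mul_left (SetLike.coe_subset_coe.2 le_sup_left)
  have hchain : PrimeChain ⊥ (V ⊔ ⊥) (V ⊔ X) := by
    refine (primeChain_of_isPGroup hX bot_le).lift (fun Y => V ⊔ Y) fun Y Z _ hZ hYZ =>
      ⟨sup_le_sup_left hYZ.1 _, ?_, bot_le, bot_le⟩
    rw [hidx Y Z hZ]
    exact relIndex_dvd_of_le_left _ le_sup_right
  rw [sup_bot_eq] at hchain
  obtain ⟨M, hVM, hMJ, hJM, hM⟩ := hchain.exists_normal_isPGroup hV (by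
    intro r hr hrJ
    have h1 := relIndex_mul_relIndex ⊥ V (V ⊔ X) bot_le le_sup_left
    have h2 := hidx ⊥ X le_rfl
    rw [sup_bot_eq] at h2
    rw [relIndex_bot_left, relIndex_bot_left, h2] at h1
    obtain ⟨a, ha⟩ := IsPGroup.iff_card.1 hV
    obtain ⟨b, hb⟩ := IsPGroup.iff_card.1 hX
    have h3 : r ∣ p ^ a * q ^ b := by
      rw [← ha, ← hb]
      exact hrJ.trans (h1 ▸ mul_dvd_mul_left _ (relIndex_dvd_card _ _))
    rcases hr.dvd_mul.1 h3 with h4 | h4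
    · exact Nat.le_of_dvd hp.out.pos (hr.dvd_of_dvd_pow h4)
    · exact (Nat.le_of_dvd hq.out.pos (hr.dvd_of_dvd_pow h4)).trans hqp.le)
  have hMV : M = V := by
    refine le_antisymm (fun m hm => ?_) hVM
    have hm' : m ∈ ((V ⊔ X : Subgroup G) : Set G) := hMJ hm
    rw [hcoe X le_rfl] at hm'
    obtain ⟨x, hx, v, hv, rfl⟩ := hm'
    have hxM : x ∈ M := by simpa using M.mul_mem hm (M.inv_mem (hVM hv))
    have : x = 1 := disjoint_def.1 (IsPGroup.disjoint_of_ne q p hqp.ne X M hX hM) hx hxM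
    simpa [this] using hv
  rw [hMV] at hJM
  rw [le_normalizer_iff]
  intro x hx u hu
  have hxu : x * u ∈ (U : Set G) * (X : Set G) := by
    rw [← h.2 U hU]
    exact Set.mul_mem_mul hx hu
  obtain ⟨u', hu', x', hx', he⟩ := hxu
  have he : u' * x' = x * u := he
  have h1 : x * u * x⁻¹ ∈ V :=
    (mem_normalizer_iff.1 (hJM ((le_sup_right : X ≤ V ⊔ X) hx)) u).1 (hU hu)
  have h2 : x' * x⁻¹ = u'⁻¹ * (x * u * x⁻¹) := by rw [← he]; group
  have h3 : x' * x⁻¹ = 1 := by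
    refine hdisj _ (X.mul_mem hx' (X.inv_mem hx)) ?_
    rw [h2]
    exact V.mul_mem (V.inv_mem (hU hu')) h1
  rw [h3] at h2
  rwa [← inv_mul_eq_one.1 h2.symm]

theorem MutuallyPermutable.symm {A B : Subgroup G} (h : MutuallyPermutable A B) :
    MutuallyPermutable B A :=
  ⟨fun U hU => (h.2 U hU).symm, fun V hV => (h.1 V hV).symm⟩

/-- The configuration that arises from an msp-permutable product `G = AB` and the largest prime
`p`: normal Sylow `p`-subgroups `P`, `R`, `S` of `A`, `B` and `G` with `S = PR`, where the Sylow
`q`-subgroups of `A` for `q ≠ p` normalize all subgroups of `R`, and those of `B` all subgroups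
of `P`. -/
structure PowerFactorization (p : ℕ) (A B : Subgroup G) (P : Sylow p A) (R : Sylow p B)
    (S : Sylow p G) : Prop where
  mul_eq : (A : Set G) * (B : Set G) = Set.univ
  normal_left : (P : Subgroup A).Normal
  normal_right : (R : Subgroup B).Normal
  coe_eq : ((S : Subgroup G) : Set G) =
    ((P : Subgroup A).map A.subtype : Set G) * ((R : Subgroup B).map B.subtype : Set G)
  power_left : ∀ q : ℕ, q.Prime → q ≠ p → ∀ (Q : Sylow q A) (U : Subgroup G),
    U ≤ (R : Subgroup B).map B.subtype → (Q : Subgroup A).map A.subtype ≤ normalizer (U : Set G)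
  power_right : ∀ q : ℕ, q.Prime → q ≠ p → ∀ (Q : Sylow q B) (U : Subgroup G),
    U ≤ (P : Subgroup A).map A.subtype → (Q : Subgroup B).map B.subtype ≤ normalizer (U : Set G)

theorem PowerFactorization.symm {p : ℕ} {A B : Subgroup G} {P : Sylow p A} {R : Sylow p B}
    {S : Sylow p G} (h : PowerFactorization p A B P R S) : PowerFactorization p B A R P S where
  mul_eq := mul_comm_eq_univ h.mul_eq
  normal_left := h.normal_right
  normal_right := h.normal_left
  coe_eq := by
    have := congrArg (·⁻¹) h.coe_eq
    simpa only [mul_inv_rev, inv_coe_set] using this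
  power_left := h.power_right
  power_right := h.power_left

theorem le_normalizer_map_of_normal {A : Subgroup G} (P : Subgroup A) [P.Normal] :
    A ≤ normalizer (P.map A.subtype : Set G) := by
  have := le_normalizer_map (H := P) A.subtype
  rwa [normalizer_eq_top, ← MonoidHom.range_eq_map, range_subtype] at this

theorem PowerFactorization.le_normalizer [Finite G] {p : ℕ} [Fact p.Prime] {A B : Subgroup G}
    {P : Sylow p A} {R : Sylow p B} {S : Sylow p G} (h : PowerFactorization p A B P R S) :
    A ≤ normalizer ((S : Subgroup G) : Set G) := by
  have hPn := h.normal_left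
  rw [← subgroupOf_eq_top]
  refine eq_top_of_sylow_le fun q hq => ?_
  rcases eq_or_ne q p with rfl | hqp
  · refine ⟨P, fun x hx => mem_subgroupOf.2 ((S : Subgroup G).le_normalizer ?_)⟩
    rw [← SetLike.mem_coe, h.coe_eq]
    exact ⟨x, mem_map_of_mem _ hx, 1, one_mem _, mul_one _⟩
  · have := Fact.mk hq
    refine ⟨default, fun x hx => mem_subgroupOf.2 ?_⟩
    have h1 := h.power_left q hq hqp default _ le_rfl (mem_map_of_mem A.subtype hx)
    have h2 := le_normalizer_map_of_normal (P : Subgroup A) x.2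
    rw [mem_normalizer_iff_conj_image_eq] at h1 h2 ⊢
    rw [h.coe_eq, Set.image_mul]
    exact congrArg₂ _ h2 h1

theorem PowerFactorization.normal [Finite G] {p : ℕ} [Fact p.Prime] {A B : Subgroup G}
    {P : Sylow p A} {R : Sylow p B} {S : Sylow p G} (h : PowerFactorization p A B P R S) :
    (S : Subgroup G).Normal := by
  refine normal_of_top_le_normalizer fun g _ => ?_
  obtain ⟨a, ha, b, hb, rfl⟩ : g ∈ (A : Set G) * (B : Set G) := h.mul_eq ▸ Set.mem_univ g
  exact mul_mem (h.le_normalizer ha) (h.symm.le_normalizer hb)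

theorem IsMspPermutable.exists_powerFactorization [Finite G] {A B : Subgroup G}
    (hprod : (A : Set G) * (B : Set G) = Set.univ) (h : IsMspPermutable A B)
    (hA : IsVSupersoluble A) (hB : IsVSupersoluble B) {p : ℕ} [hp : Fact p.Prime]
    (hmax : ∀ r : ℕ, r.Prime → r ∣ Nat.card G → r ≤ p) :
    ∃ P R S, PowerFactorization p A B P R S := by
  obtain ⟨P, R, S, hS⟩ := exists_sylow_mul p hprod
  have hlt : ∀ (H : Subgroup G) (q : ℕ), q.Prime → q ≠ p → ∀ Q : Sylow q H,
      (Q : Subgroup H).map H.subtype = ⊥ ∨ q < p := by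
    intro H q hq hqp Q
    have := Fact.mk hq
    rcases Q.isPGroup'.card_eq_or_dvd with h1 | h1
    · rw [card_eq_one.1 h1, Subgroup.map_bot]
      exact Or.inl rfl
    · exact Or.inr ((hmax q hq (h1.trans ((card_subgroup_dvd_card _).trans
        (card_subgroup_dvd_card H)))).lt_of_ne hqp)
  refine ⟨P, R, S, hprod, hA.normal_sylow (fun r hr h => hmax r hr
    (h.trans (card_subgroup_dvd_card A))) P, hB.normal_sylow (fun r hr h => hmax r hr
    (h.trans (card_subgroup_dvd_card B))) R, hS, ?_, ?_⟩
  · intro q hq hqp Q U hU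
    have := Fact.mk hq
    rcases hlt A q hq hqp Q with h1 | h1
    · rw [h1]
      exact bot_le
    · exact (h.2 q p hq hp.out hqp Q R).le_normalizer h1 (Q.isPGroup'.map _) (R.isPGroup'.map _) hU
  · intro q hq hqp Q U hU
    have := Fact.mk hq
    rcases hlt B q hq hqp Q with h1 | h1
    · rw [h1]
      exact bot_le
    · exact (h.2 p q hp.out hq hqp.symm P Q).symm.le_normalizer h1 (Q.isPGroup'.map _)
        (P.isPGroup'.map _) hU

theorem MutuallyPermutable.map {A B : Subgroup G} (h : MutuallyPermutable A B) (f : G →* G') :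
    MutuallyPermutable (A.map f) (B.map f) := by
  have key : ∀ {C : Subgroup G} {U : Subgroup G'}, U ≤ C.map f → (C ⊓ U.comap f).map f = U := by
    refine fun hU => le_antisymm (map_le_iff_le_comap.2 inf_le_right) fun u hu => ?_
    obtain ⟨c, hc, rfl⟩ := hU hu
    exact mem_map_of_mem f ⟨hc, hu⟩
  constructor
  · intro U hU
    rw [← key hU, coe_map, coe_map, ← Set.image_mul, ← Set.image_mul,
      h.1 _ inf_le_left]
  · intro V hV
    rw [← key hV, coe_map, coe_map, ← Set.image_mul, ← Set.image_mul,
      h.2 _ inf_le_left]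

theorem exists_sylow_map [Finite G] {A : Subgroup G} (f : G →* G') {p : ℕ} [Fact p.Prime]
    (Q : Sylow p (A.map f)) : ∃ P : Sylow p A, (Q : Subgroup (A.map f)).map (A.map f).subtype =
      ((P : Subgroup A).map A.subtype).map f := by
  obtain ⟨P, rfl⟩ := Sylow.mapSurjective_surjective (f.subgroupMap_surjective A) p Q
  refine ⟨P, ?_⟩
  rw [Sylow.coe_mapSurjective, map_map, map_map]
  rfl

theorem IsMspPermutable.map [Finite G] {A B : Subgroup G} (h : IsMspPermutable A B) (f : G →* G') :
    IsMspPermutable (A.map f) (B.map f) := by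
  obtain ⟨⟨H, hH⟩, h2⟩ := h
  refine ⟨⟨H.map f, by rw [coe_map, hH, Set.image_mul, coe_map, coe_map]⟩, ?_⟩
  intro p q hp hq hpq P Q
  have := Fact.mk hp
  have := Fact.mk hq
  obtain ⟨P', hP'⟩ := exists_sylow_map f P
  obtain ⟨Q', hQ'⟩ := exists_sylow_map f Q
  rw [hP', hQ']
  exact (h2 p q hp hq hpq P' Q').map f

/-! ### Criteria for membership in the three classes -/

theorem IsSupersoluble.of_actsAbelian [Finite G] {p : ℕ} [Fact p.Prime] {S : Subgroup G}
    [S.Normal] (hS : IsPGroup p S) (hquot : IsSupersoluble (G ⧸ S)) (h : ActsAbelian p S ⊤) :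
    IsSupersoluble G := by
  rw [isSupersoluble_iff] at *
  have h1 := hquot.comap (QuotientGroup.mk'_surjective S)
  rw [comap_top, MonoidHom.comap_bot, QuotientGroup.ker_mk'] at h1
  exact (h.primeChain hS).trans h1

/-- A chain from `H` to `HS` continues to `G` if the image of `H` in `G / S` is `ℙ`-subnormal. -/
theorem IsPrimeSubnormal.of_quotient {S H : Subgroup G} [S.Normal]
    (hquot : IsPrimeSubnormal (H.map (QuotientGroup.mk' S))) (h : PrimeChain ⊥ H (H ⊔ S)) :
    IsPrimeSubnormal H := by
  have h1 := hquot.comap (QuotientGroup.mk'_surjective S)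
  rw [comap_map_eq, QuotientGroup.ker_mk'] at h1
  rw [isPrimeSubnormal_iff] at *
  exact h.trans h1

theorem ActsAbelian.primeChain_sup [Finite G] {p : ℕ} [Fact p.Prime] {S T : Subgroup G}
    [S.Normal] (hS : IsPGroup p S) (h : ActsAbelian p S T) : PrimeChain ⊥ T (T ⊔ S) := by
  simpa using (h.primeChain hS).sup

theorem IsWSupersoluble.of_actsAbelian [Finite G] {p : ℕ} [hp : Fact p.Prime] {S : Sylow p G}
    [hSn : (S : Subgroup G).Normal] (hquot : IsWSupersoluble (G ⧸ (S : Subgroup G)))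
    (h : ∀ q : ℕ, q.Prime → q ≠ p → ∀ Q : Sylow q G, ActsAbelian p (S : Subgroup G) Q) :
    IsWSupersoluble G := by
  intro q hq Q
  have := Fact.mk hq
  refine IsPrimeSubnormal.of_quotient (S := (S : Subgroup G)) ?_ ?_
  · exact hquot q hq (Q.mapSurjective (QuotientGroup.mk'_surjective _))
  · rcases eq_or_ne q p with rfl | hqp
    · rw [sup_eq_left.2 (S.isPGroup'.le_sylow_of_normal Q)]
      exact .refl
    · exact (h q hq hqp Q).primeChain_sup S.isPGroup'

theorem IsVSupersoluble.of_actsAbelian [Finite G] {p : ℕ} [hp : Fact p.Prime] {S : Sylow p G}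
    [hSn : (S : Subgroup G).Normal] (hquot : IsVSupersoluble (G ⧸ (S : Subgroup G)))
    (h : ∀ q k : ℕ, q.Prime → q ≠ p → ∀ c : G, orderOf c = q ^ k →
      ActsAbelian p (S : Subgroup G) (zpowers c)) :
    IsVSupersoluble G := by
  rintro C hC ⟨q, k, hq, hCk⟩
  have := Fact.mk hq
  obtain ⟨c, rfl⟩ := (Subgroup.isCyclic_iff_exists_zpowers_eq_top C).1 hC
  have hCp : IsPGroup q (zpowers c) := IsPGroup.of_card hCk
  rw [Nat.card_zpowers] at hCk
  refine IsPrimeSubnormal.of_quotient (S := (S : Subgroup G)) ?_ ?_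
  · obtain ⟨j, hj⟩ := IsPGroup.iff_card.1 (hCp.map (QuotientGroup.mk' (S : Subgroup G)))
    exact hquot _ (by rw [MonoidHom.map_zpowers]; infer_instance) ⟨q, j, hq, hj⟩
  · rcases eq_or_ne q p with rfl | hqp
    · obtain ⟨Q, hQ⟩ := hCp.exists_le_sylow
      have := S.unique_of_normal hSn
      rw [Subsingleton.elim Q S] at hQ
      rw [sup_eq_right.2 hQ]
      exact primeChain_of_isPGroup S.isPGroup' hQ
    · exact (h q k hq hqp c hCk).primeChain_sup S.isPGroup'

theorem IsSupersoluble.actsAsPElement [Finite G] (hG : IsSupersoluble G) {p : ℕ} [Fact p.Prime]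
    {S : Subgroup G} [S.Normal] (hS : IsPGroup p S) (x y : G) :
    ActsAsPElement p S ⁅x, y⁆ ∧ ActsAsPElement p S (x ^ (p - 1)) := by
  rw [isSupersoluble_iff] at hG
  have := hG.inf_normal S
  rw [bot_inf_eq, top_inf_eq] at this
  exact this.actsAsPElement hS (mem_top x) (mem_top y)

/-- Intersecting a prime chain from `H` to `G` with `S` gives an `H`-invariant chain of `S`. -/
theorem IsPrimeSubnormal.actsAsPElement [Finite G] {p : ℕ} [Fact p.Prime] {H S : Subgroup G}
    (hH : IsPrimeSubnormal H) [S.Normal] (hS : IsPGroup p S) (hd : Disjoint H S) {x y : G}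
    (hx : x ∈ H) (hy : y ∈ H) :
    ActsAsPElement p S ⁅x, y⁆ ∧ ActsAsPElement p S (x ^ (p - 1)) := by
  have := (isPrimeSubnormal_iff.1 hH).of_bot.inf_normal S
  rw [hd.eq_bot, top_inf_eq] at this
  exact this.actsAsPElement hS hx hy

theorem ActsAsPElement.map {p : ℕ} {V : Subgroup G} {g : G} (h : ActsAsPElement p V g)
    (f : G →* G') : ActsAsPElement p (V.map f) (f g) := by
  obtain ⟨n, hn⟩ := h
  refine ⟨n, ?_⟩
  rintro _ ⟨v, hv, rfl⟩
  rw [← map_pow]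
  exact (hn v hv).map f

theorem ActsAsPElement.inv {p : ℕ} {V : Subgroup G} {g : G} (h : ActsAsPElement p V g) :
    ActsAsPElement p V g⁻¹ := by
  obtain ⟨n, hn⟩ := h
  exact ⟨n, fun v hv => by rw [inv_pow]; exact (hn v hv).inv_left⟩

/-! ### The action on the normal Sylow subgroup -/

/-- The elements of `A` that normalize every subgroup of `V`. -/
def powerPart (A V : Subgroup G) : Subgroup G :=
  A ⊓ ⨅ U : Set.Iic V, normalizer ((U : Subgroup G) : Set G)

theorem mem_powerPart {A V : Subgroup G} {x : G} :
    x ∈ powerPart A V ↔ x ∈ A ∧ ∀ U ≤ V, x ∈ normalizer (U : Set G) := by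
  simp [powerPart, mem_inf, mem_iInf]

/-- A subgroup `T` whose elements are, modulo `S C_G(S)`, products `xy` with `x ∈ X` and `y ∈ Y`,
acts abelianly on `S` if the elements of `X ∪ Y` commute and have exponent dividing `p - 1` modulo
`S C_G(S)`. -/
theorem ActsAbelian.of_mul {p : ℕ} {S T : Subgroup G} [S.Normal] {X Y : Set G}
    (hT : ∀ g ∈ T, ∃ x ∈ X, ∃ y ∈ Y, ∃ d ∈ S ⊔ centralizer (S : Set G), g = x * y * d)
    (hXX : ∀ x ∈ X, ∀ y ∈ X, ⁅x, y⁆ ∈ S ⊔ centralizer (S : Set G))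
    (hYY : ∀ x ∈ Y, ∀ y ∈ Y, ⁅x, y⁆ ∈ S ⊔ centralizer (S : Set G))
    (hXY : ∀ x ∈ X, ∀ y ∈ Y, ⁅x, y⁆ ∈ S ⊔ centralizer (S : Set G))
    (hX : ∀ x ∈ X, x ^ (p - 1) ∈ S ⊔ centralizer (S : Set G))
    (hY : ∀ y ∈ Y, y ^ (p - 1) ∈ S ⊔ centralizer (S : Set G)) : ActsAbelian p S T := by
  let π := QuotientGroup.mk' (S ⊔ centralizer (S : Set G))
  have hker : ∀ g, g ∈ S ⊔ centralizer (S : Set G) ↔ π g = 1 :=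
    fun g => (QuotientGroup.eq_one_iff g).symm
  have hcomm : ∀ x y : G, ⁅x, y⁆ ∈ S ⊔ centralizer (S : Set G) → Commute (π x) (π y) := by
    intro x y h
    rwa [hker, map_commutatorElement, commutatorElement_eq_one_iff_commute] at h
  have hT' : ∀ g ∈ T, ∃ x ∈ X, ∃ y ∈ Y, π g = π x * π y := by
    intro g hg
    obtain ⟨x, hx, y, hy, d, hd, rfl⟩ := hT g hg
    exact ⟨x, hx, y, hy, by rw [map_mul, (hker d).1 hd, mul_one, map_mul]⟩
  constructor
  · intro g hg g' hg'
    obtain ⟨x, hx, y, hy, h1⟩ := hT' g hg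
    obtain ⟨x', hx', y', hy', h2⟩ := hT' g' hg'
    rw [hker, map_commutatorElement, commutatorElement_eq_one_iff_commute, h1, h2]
    have h3 := hcomm _ _ (hXX x hx x' hx')
    have h4 := hcomm _ _ (hXY x hx y' hy')
    have h5 := hcomm _ _ (hXY x' hx' y hy)
    have h6 := hcomm _ _ (hYY y hy y' hy')
    exact (h3.mul_right h4).mul_left (h5.symm.mul_right h6)
  · intro g hg
    obtain ⟨x, hx, y, hy, h1⟩ := hT' g hg
    rw [hker, map_pow, h1, (hcomm _ _ (hXY x hx y hy)).mul_pow, ← map_pow, ← map_pow,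
      (hker _).1 (hX x hx), (hker _).1 (hY y hy), one_mul]

theorem ActsAbelian.conj {p : ℕ} {S T : Subgroup G} [S.Normal] (h : ActsAbelian p S T) (g : G) :
    ActsAbelian p S (T.map (MulAut.conj g).toMonoidHom) := by
  have hD : (S ⊔ centralizer (S : Set G)).Normal := inferInstance
  constructor
  · rintro _ ⟨x, hx, rfl⟩ _ ⟨y, hy, rfl⟩
    rw [← map_commutatorElement]
    exact hD.conj_mem _ (h.1 x hx y hy) g
  · rintro _ ⟨x, hx, rfl⟩
    rw [← map_pow]
    exact hD.conj_mem _ (h.2 x hx) g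

namespace PowerFactorization

theorem map_sylow_le_powerPart {p : ℕ} {A B : Subgroup G} {P : Sylow p A}
    {R : Sylow p B} {S : Sylow p G} (h : PowerFactorization p A B P R S)
    {q : ℕ} (hq : q.Prime)
    (hqp : q ≠ p) (Q : Sylow q A) :
    (Q : Subgroup A).map A.subtype ≤ powerPart A ((R : Subgroup B).map B.subtype) :=
  fun _ hx => mem_powerPart.2 ⟨map_subtype_le _ hx, fun U hU => h.power_left q hq hqp Q U hU hx⟩

variable [Finite G] {p : ℕ} [hp : Fact p.Prime] {A B : Subgroup G} {P : Sylow p A} {R : Sylow p B}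
  {S : Sylow p G}

theorem mem_of_acts (h : PowerFactorization p A B P R S) {g : G}
    (hP : ActsAsPElement p ((P : Subgroup A).map A.subtype) g)
    (hR : ActsAsPElement p ((R : Subgroup B).map B.subtype) g) :
    g ∈ (S : Subgroup G) ⊔ centralizer ((S : Subgroup G) : Set G) := by
  obtain ⟨n, hn⟩ := hP.exists_le
  obtain ⟨m, hm⟩ := hR.exists_le
  refine ActsAsPElement.mem_sup_centralizer h.normal ⟨max n m, fun v hv => ?_⟩
  rw [← SetLike.mem_coe, h.coe_eq] at hv
  obtain ⟨x, hx, y, hy, rfl⟩ := hv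
  exact (hn _ (le_max_left _ _) x hx).mul_right (hm _ (le_max_right _ _) y hy)

/-- The group `A` is generated by its normal Sylow `p`-subgroup and by its other Sylow subgroups,
which act on `R` by power automorphisms. -/
theorem exists_mul_of_mem (h : PowerFactorization p A B P R S) {a : G} (ha : a ∈ A) :
    ∃ x ∈ powerPart A ((R : Subgroup B).map B.subtype), ∃ s ∈ (S : Subgroup G), a = x * s := by
  have hPn := h.normal_left
  have h1 : (powerPart A ((R : Subgroup B).map B.subtype)).subgroupOf A ⊔ P = ⊤ := by
    refine eq_top_of_sylow_le fun q hq => ?_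
    rcases eq_or_ne q p with rfl | hqp
    · exact ⟨P, le_sup_right⟩
    · have := Fact.mk hq
      exact ⟨default, le_sup_of_le_left (map_le_iff_le_comap.1
        (h.map_sylow_le_powerPart hq hqp default))⟩
  have h2 : (⟨a, ha⟩ : A) ∈
      (((powerPart A ((R : Subgroup B).map B.subtype)).subgroupOf A ⊔ P : Subgroup A) : Set A) := by
    rw [h1]
    trivial
  rw [mul_normal] at h2
  obtain ⟨x, hx, s, hs, hxs⟩ := h2
  refine ⟨x, hx, s, ?_, (congrArg Subtype.val hxs).symm⟩
  rw [← SetLike.mem_coe, h.coe_eq]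
  exact ⟨s, mem_map_of_mem _ hs, 1, one_mem _, mul_one _⟩

/-- Modulo `S C_G(S)`, the elements of `A` acting as power automorphisms commute with those of `B`
acting as power automorphisms. -/
theorem commutator_mem (h : PowerFactorization p A B P R S) {x y : G}
    (hx : x ∈ powerPart A ((R : Subgroup B).map B.subtype))
    (hy : y ∈ powerPart B ((P : Subgroup A).map A.subtype)) :
    ⁅x, y⁆ ∈ (S : Subgroup G) ⊔ centralizer ((S : Subgroup G) : Set G) := by
  have hPn := h.normal_left
  have hRn := h.normal_right
  rw [mem_powerPart] at hx hy
  refine h.mem_of_acts ?_ ?_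
  · rw [← commutatorElement_inv]
    exact (actsAsPElement_commutator (P.isPGroup'.map _) hy.2
      (le_normalizer_map_of_normal _ hx.1)).inv
  · exact actsAsPElement_commutator (R.isPGroup'.map _) hx.2 (le_normalizer_map_of_normal _ hy.1)

theorem commutator_mem_left (h : PowerFactorization p A B P R S) {x y : G}
    (hx : x ∈ powerPart A ((R : Subgroup B).map B.subtype))
    (hy : y ∈ powerPart A ((R : Subgroup B).map B.subtype))
    (hxy : ActsAsPElement p ((P : Subgroup A).map A.subtype) ⁅x, y⁆) :
    ⁅x, y⁆ ∈ (S : Subgroup G) ⊔ centralizer ((S : Subgroup G) : Set G) :=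
  h.mem_of_acts hxy (actsAsPElement_commutator (R.isPGroup'.map _) (mem_powerPart.1 hx).2
    ((mem_powerPart.1 hy).2 _ le_rfl))

theorem pow_mem_left (h : PowerFactorization p A B P R S) {x : G}
    (hx : x ∈ powerPart A ((R : Subgroup B).map B.subtype))
    (hxp : ActsAsPElement p ((P : Subgroup A).map A.subtype) (x ^ (p - 1))) :
    x ^ (p - 1) ∈ (S : Subgroup G) ⊔ centralizer ((S : Subgroup G) : Set G) :=
  h.mem_of_acts hxp (actsAsPElement_pow (R.isPGroup'.map _) (mem_powerPart.1 hx).2)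

theorem isSupersoluble (h : PowerFactorization p A B P R S) (hA : IsSupersoluble A)
    (hB : IsSupersoluble B)
    (hquot : [(S : Subgroup G).Normal] → IsSupersoluble (G ⧸ (S : Subgroup G))) :
    IsSupersoluble G := by
  have hSn := h.normal
  have key : ∀ {A B : Subgroup G} {P : Sylow p A} {R : Sylow p B},
      PowerFactorization p A B P R S → IsSupersoluble A →
      ∀ x ∈ powerPart A ((R : Subgroup B).map B.subtype),
      (∀ y ∈ powerPart A ((R : Subgroup B).map B.subtype),
        ⁅x, y⁆ ∈ (S : Subgroup G) ⊔ centralizer ((S : Subgroup G) : Set G)) ∧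
      x ^ (p - 1) ∈ (S : Subgroup G) ⊔ centralizer ((S : Subgroup G) : Set G) := by
    intro A B P R h hA x hx
    have hPn := h.normal_left
    have h1 := fun y : A =>
      hA.actsAsPElement P.isPGroup' ⟨x, (mem_powerPart.1 hx).1⟩ y
    exact ⟨fun y hy => h.commutator_mem_left hx hy
      ((h1 ⟨y, (mem_powerPart.1 hy).1⟩).1.map A.subtype),
      h.pow_mem_left hx ((h1 1).2.map A.subtype)⟩
  refine IsSupersoluble.of_actsAbelian S.isPGroup' hquot (ActsAbelian.of_mul
    (X := powerPart A ((R : Subgroup B).map B.subtype))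
    (Y := powerPart B ((P : Subgroup A).map A.subtype)) ?_
    (fun x hx => (key h hA x hx).1) (fun x hx => (key h.symm hB x hx).1)
    (fun x hx y hy => h.commutator_mem hx hy)
    (fun x hx => (key h hA x hx).2) (fun x hx => (key h.symm hB x hx).2))
  intro g _
  obtain ⟨a, ha, b, hb, rfl⟩ : g ∈ (A : Set G) * (B : Set G) := h.mul_eq ▸ Set.mem_univ g
  obtain ⟨x, hx, s, hs, rfl⟩ := h.exists_mul_of_mem ha
  obtain ⟨y, hy, t, ht, rfl⟩ := h.symm.exists_mul_of_mem hb
  refine ⟨x, hx, y, hy, y⁻¹ * s * y * t, mem_sup_left (mul_mem ?_ ht), by group⟩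
  simpa using hSn.conj_mem s hs y⁻¹

theorem isWSupersoluble (h : PowerFactorization p A B P R S) (hA : IsWSupersoluble A)
    (hB : IsWSupersoluble B)
    (hquot : [(S : Subgroup G).Normal] → IsWSupersoluble (G ⧸ (S : Subgroup G))) :
    IsWSupersoluble G := by
  have hSn := h.normal
  refine IsWSupersoluble.of_actsAbelian hquot fun q hq hqp Q => ?_
  have := Fact.mk hq
  have key : ∀ {A B : Subgroup G} {P : Sylow p A} {R : Sylow p B},
      PowerFactorization p A B P R S → IsWSupersoluble A → ∀ Q : Sylow q A,
      ∀ x ∈ (Q : Subgroup A).map A.subtype,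
      (∀ y ∈ (Q : Subgroup A).map A.subtype,
        ⁅x, y⁆ ∈ (S : Subgroup G) ⊔ centralizer ((S : Subgroup G) : Set G)) ∧
      x ^ (p - 1) ∈ (S : Subgroup G) ⊔ centralizer ((S : Subgroup G) : Set G) := by
    intro A B P R h hA Q x hx
    have hPn := h.normal_left
    have hle := h.map_sylow_le_powerPart hq hqp Q
    obtain ⟨x, hxQ, rfl⟩ := hx
    have h1 := fun (y : A) (hy : y ∈ (Q : Subgroup A)) => (hA q hq Q).actsAsPElement P.isPGroup'
      (IsPGroup.disjoint_of_ne q p hqp _ _ Q.isPGroup' P.isPGroup') hxQ hy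
    refine ⟨?_, h.pow_mem_left (hle (mem_map_of_mem _ hxQ)) ((h1 1 (one_mem _)).2.map A.subtype)⟩
    rintro _ ⟨y, hyQ, rfl⟩
    exact h.commutator_mem_left (hle (mem_map_of_mem _ hxQ)) (hle (mem_map_of_mem _ hyQ))
      ((h1 y hyQ).1.map A.subtype)
  obtain ⟨QA, QB, Q₀, hQ₀⟩ := exists_sylow_mul q h.mul_eq
  have h0 : ActsAbelian p (S : Subgroup G) Q₀ := by
    refine ActsAbelian.of_mul (X := (QA : Subgroup A).map A.subtype)
      (Y := (QB : Subgroup B).map B.subtype) ?_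
      (fun x hx => (key h hA QA x hx).1) (fun x hx => (key h.symm hB QB x hx).1)
      (fun x hx y hy => h.commutator_mem (h.map_sylow_le_powerPart hq hqp QA hx)
        (h.symm.map_sylow_le_powerPart hq hqp QB hy))
      (fun x hx => (key h hA QA x hx).2) (fun x hx => (key h.symm hB QB x hx).2)
    intro g hg
    rw [← SetLike.mem_coe, hQ₀] at hg
    obtain ⟨x, hx, y, hy, rfl⟩ := hg
    exact ⟨x, hx, y, hy, 1, one_mem _, (mul_one _).symm⟩
  obtain ⟨g, rfl⟩ := MulAction.exists_smul_eq G Q₀ Q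
  exact h0.conj g

theorem isVSupersoluble (h : PowerFactorization p A B P R S) (hA : IsVSupersoluble A)
    (hB : IsVSupersoluble B)
    (hquot : [(S : Subgroup G).Normal] → IsVSupersoluble (G ⧸ (S : Subgroup G))) :
    IsVSupersoluble G := by
  have hSn := h.normal
  refine IsVSupersoluble.of_actsAbelian hquot fun q k hq hqp c hc => ?_
  have := Fact.mk hq
  have key : ∀ {A B : Subgroup G} {P : Sylow p A} {R : Sylow p B},
      PowerFactorization p A B P R S → IsVSupersoluble A → ∀ Q : Sylow q A,
      ∀ x ∈ (Q : Subgroup A).map A.subtype,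
      x ^ (p - 1) ∈ (S : Subgroup G) ⊔ centralizer ((S : Subgroup G) : Set G) := by
    intro A B P R h hA Q x hx
    have hPn := h.normal_left
    have hle := h.map_sylow_le_powerPart hq hqp Q
    obtain ⟨x, hxQ, rfl⟩ := hx
    obtain ⟨j, hj⟩ := IsPGroup.iff_orderOf.1 Q.isPGroup' ⟨x, hxQ⟩
    rw [orderOf_mk] at hj
    have h1 := (hA.isPrimeSubnormal_zpowers hq hj).actsAsPElement P.isPGroup'
      (IsPGroup.disjoint_of_ne q p hqp _ _ (Q.isPGroup'.to_le (zpowers_le.2 hxQ)) P.isPGroup')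
      (mem_zpowers x) (mem_zpowers x)
    exact h.pow_mem_left (hle (mem_map_of_mem _ hxQ)) (h1.2.map A.subtype)
  obtain ⟨QA, QB, Q₀, hQ₀⟩ := exists_sylow_mul q h.mul_eq
  obtain ⟨Q, hQ⟩ := (IsPGroup.of_card (by rw [Nat.card_zpowers, hc]) :
    IsPGroup q (zpowers c)).exists_le_sylow
  obtain ⟨g, rfl⟩ := MulAction.exists_smul_eq G Q₀ Q
  obtain ⟨c₀, hc₀, rfl⟩ := hQ (mem_zpowers c)
  have hc₀' : c₀ ∈ ((Q₀ : Subgroup G) : Set G) := hc₀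
  rw [hQ₀] at hc₀'
  obtain ⟨x, hx, y, hy, hxy⟩ := hc₀'
  have hxA := h.map_sylow_le_powerPart hq hqp QA hx
  have hyB := h.symm.map_sylow_le_powerPart hq hqp QB hy
  have hD : ((S : Subgroup G) ⊔ centralizer ((S : Subgroup G) : Set G)).Normal := inferInstance
  have h0 : ActsAbelian p (S : Subgroup G) (zpowers c₀) := by
    have hself : ∀ z : G, ∀ a ∈ zpowers z, ∀ b ∈ zpowers z,
        ⁅a, b⁆ ∈ (S : Subgroup G) ⊔ centralizer ((S : Subgroup G) : Set G) := by
      rintro z _ ⟨i, rfl⟩ _ ⟨j, rfl⟩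
      rw [commutatorElement_eq_one_iff_commute.2 (Commute.zpow_zpow_self z i j)]
      exact one_mem _
    refine ActsAbelian.of_mul (X := zpowers x) (Y := zpowers y) ?_ (hself x) (hself y)
      (fun a ha b hb => h.commutator_mem (zpowers_le.2 hxA ha) (zpowers_le.2 hyB hb))
      (fun a ha => key h hA QA a (zpowers_le.2 hx ha))
      (fun b hb => key h.symm hB QB b (zpowers_le.2 hy hb))
    rintro _ ⟨i, rfl⟩
    -- modulo `S C_G(S)`, the commuting elements `x` and `y` satisfy `(xy)^i = x^i y^i`
    refine ⟨x ^ i, zpow_mem (mem_zpowers x) i, y ^ i, zpow_mem (mem_zpowers y) i,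
      (x ^ i * y ^ i)⁻¹ * c₀ ^ i, ?_, by group⟩
    have h1 := h.commutator_mem hxA hyB
    rw [← QuotientGroup.eq_one_iff] at h1 ⊢
    have h2 : Commute (x : G ⧸ ((S : Subgroup G) ⊔ centralizer ((S : Subgroup G) : Set G))) y :=
      commutatorElement_eq_one_iff_commute.1 h1
    have hxy : x * y = c₀ := hxy
    rw [← hxy, QuotientGroup.mk_mul, QuotientGroup.mk_inv, QuotientGroup.mk_mul,
      QuotientGroup.mk_zpow, QuotientGroup.mk_zpow, QuotientGroup.mk_zpow, QuotientGroup.mk_mul,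
      h2.mul_zpow, inv_mul_cancel]
  have := h0.conj g
  rw [MonoidHom.map_zpowers] at this
  exact this

end PowerFactorization

/-! ### Induction on the order -/

theorem IsSupersoluble.of_subsingleton [Subsingleton G] : IsSupersoluble G :=
  fun _ _ h => absurd (Subsingleton.elim _ _) h.2.2.1.ne

/-- A class of v-supersoluble groups that contains the trivial groups and is closed under quotients
is closed under msp-permutable products, if it allows the passage from `G / S` to `G` for the
normal Sylow subgroup `S` belonging to the largest prime. -/
theorem mem_of_isMspPermutable (F : ∀ (G : Type u) [Group G], Prop)
    (htriv : ∀ (G : Type u) [Group G] [Finite G], Subsingleton G → F G)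
    (hv : ∀ (G : Type u) [Group G] [Finite G], F G → IsVSupersoluble G)
    (hmap : ∀ (G H : Type u) [Group G] [Group H] [Finite G] (f : G →* H),
      Function.Surjective f → F G → F H)
    (hstep : ∀ (G : Type u) [Group G] [Finite G] (p : ℕ) [Fact p.Prime] (A B : Subgroup G)
      (P : Sylow p A) (R : Sylow p B) (S : Sylow p G), PowerFactorization p A B P R S →
      F A → F B → ([(S : Subgroup G).Normal] → F (G ⧸ (S : Subgroup G))) → F G)
    (n : ℕ) : ∀ (G : Type u) [Group G] [Finite G] (A B : Subgroup G), Nat.card G = n →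
      (A : Set G) * (B : Set G) = Set.univ → IsMspPermutable A B → F A → F B → F G := by
  induction n using Nat.strong_induction_on with
  | _ n ih =>
  intro G _ _ A B hn hprod hmsp hA hB
  rcases subsingleton_or_nontrivial G with hG | hG
  · exact htriv G hG
  have hne : (Nat.card G).primeFactors.Nonempty := Nat.nonempty_primeFactors.2 Finite.one_lt_card
  obtain ⟨p, hp, hmax⟩ := (Nat.card G).primeFactors.exists_max_image id hne
  have := Fact.mk (Nat.prime_of_mem_primeFactors hp)
  obtain ⟨P, R, S, h⟩ := hmsp.exists_powerFactorization hprod (hv A hA) (hv B hB) (p := p)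
    fun r hr hrG => hmax r (Nat.mem_primeFactors.2 ⟨hr, hrG, Nat.card_pos.ne'⟩)
  refine hstep G p A B P R S h hA hB ?_
  intro hSn
  have hlt : Nat.card (G ⧸ (S : Subgroup G)) < n := by
    have h1 := (S : Subgroup G).index_mul_card
    have h2 : 1 < Nat.card S := (S : Subgroup G).one_lt_card_iff_ne_bot.2
      (S.ne_bot_of_dvd_card (Nat.dvd_of_mem_primeFactors hp))
    rw [index_eq_card] at h1
    rw [← hn, ← h1]
    exact lt_mul_of_one_lt_right Nat.card_pos h2
  let f := QuotientGroup.mk' (S : Subgroup G)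
  have hf : Function.Surjective f := QuotientGroup.mk'_surjective _
  refine ih _ hlt _ (A.map f) (B.map f) rfl ?_ (hmsp.map f)
    (hmap A _ _ (f.subgroupMap_surjective A) hA) (hmap B _ _ (f.subgroupMap_surjective B) hB)
  rw [coe_map, coe_map, ← Set.image_mul, hprod, Set.image_univ, hf.range_eq]

end MspPermutable

theorem mainTheorem2 {G : Type*} [Group G] [Finite G] (G₁ G₂ : Subgroup G)
    (hprod : (G₁ : Set G) * (G₂ : Set G) = Set.univ)
    (hmsp : MspPermutable.IsMspPermutable G₁ G₂) :
    (MspPermutable.IsSupersoluble G₁ → MspPermutable.IsSupersoluble G₂ →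
      MspPermutable.IsSupersoluble G) ∧
    (MspPermutable.IsWSupersoluble G₁ → MspPermutable.IsWSupersoluble G₂ →
      MspPermutable.IsWSupersoluble G) ∧
    (MspPermutable.IsVSupersoluble G₁ → MspPermutable.IsVSupersoluble G₂ →
      MspPermutable.IsVSupersoluble G) := by
  refine ⟨?_, ?_, ?_⟩
  · exact MspPermutable.mem_of_isMspPermutable (fun G _ => MspPermutable.IsSupersoluble G)
      (fun G _ _ _ => .of_subsingleton) (fun G _ _ h => h.isWSupersoluble.isVSupersoluble)
      (fun G H _ _ _ f hf h => h.of_surjective hf)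
      (fun G _ _ p _ A B P R S h hA hB hquot => h.isSupersoluble hA hB hquot)
      _ G G₁ G₂ rfl hprod hmsp
  · exact MspPermutable.mem_of_isMspPermutable (fun G _ => MspPermutable.IsWSupersoluble G)
      (fun G _ _ _ => MspPermutable.IsSupersoluble.of_subsingleton.isWSupersoluble)
      (fun G _ _ h => h.isVSupersoluble)
      (fun G H _ _ _ f hf h => h.of_surjective hf)
      (fun G _ _ p _ A B P R S h hA hB hquot => h.isWSupersoluble hA hB hquot)
      _ G G₁ G₂ rfl hprod hmsp
  · exact MspPermutable.mem_of_isMspPermutable (fun G _ => MspPermutable.IsVSupersoluble G)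
      (fun G _ _ _ =>
        MspPermutable.IsSupersoluble.of_subsingleton.isWSupersoluble.isVSupersoluble)
      (fun G _ _ h => h)
      (fun G H _ _ _ f hf h => h.of_surjective hf)
      (fun G _ _ p _ A B P R S h hA hB hquot => h.isVSupersoluble hA hB hquot)
      _ G G₁ G₂ rfl hprod hmsp
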